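/- Let $n\ge 1$, $G=\mathrm{SL}_n(\mathbb R)$, and let $E_{ij}$ be the matrix units. Let $\mathfrak l=\mathrm{span}\{E_{ij}: i>j\}$ and $\mathfrak u=\mathrm{span}\{E_{ij}: i<j\}$ be the Lie algebras of strictly lower and strictly upper triangular matrices, with Lebesgue measures $dX$, $dY$ in the coordinates given by the $E_{ij}$. Let $D_1\subset G$ be the group of real diagonal matrices of determinant $1$ (entries of either sign), with the measure $$da=\prod_{i=1}^{n-1}\frac{da_{ii}}{|a_{ii}|}$$ in the coordinates $(a_{11},\dots,a_{n-1,n-1})\in(\mathbb R\setminus\{0\})^{n-1}$, and let $\mathfrak d_1$ be its Lie algebra, the traceless diagonal matrices. **Digit laws.** Give $\mathfrak{sl}_n(\mathbb R)$ the inner product $\langle X,Y\rangle=\mathrm{tr}(X^TY)$ with norm $|\cdot|$. For a finite family $H=(H_i)_{i\in I}$ of linearly independent elements of $\mathfrak d_1$, a set $J\subset\mathbb R^I$ and $\epsilon>0$, let $$T_\epsilon(H,J)=\Big\{\exp\Big(\sum_i t_iH_i\Big)\exp(Y)\ :\ t\in J,\ Y\in\mathfrak{sl}_n(\mathbb R),\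 Y\perp H_i\ \forall i,\ |Y|<\epsilon\Big\}$$ be the tube of radius $\epsilon$ around $\{\exp(\sum_i t_iH_i):t\in J\}$. For $B>1$ and $x\neq0$ let $S_B(x)\in[1,B)$ be the significand, $|x|=S_B(x)B^k$ with $k\in\mathbb Z$. **Theorem.** The measure $da$ is a Haar measure on $D_1$, and $G$ has a (suitably normalized) Haar measure $\mu$ such that for every continuous compactly supported $\phi:G\to\mathbb C$ the function $(X,Y,a)\mapsto\phi(\exp(X)\exp(Y)a)$ is integrable with respect to $dX\,dY\,da$ and $$\int_G\phi\,d\mu=\int_{\mathfrak l}\int_{\mathfrak u}\int_{D_1}\phi(\exp(X)\exp(Y)a)\;da\,dY\,dX .$$ Consequently, for every real base $B>1$, the following hold. 1. *(Digit law along diagonal directions.)* For every finite linearly independent family $H=(H_i)_{i\in I}$ in $\mathfrak d_1$ and all $s\in[1,B)^I$, $$\lim_{k\to\infty}\lim_{\epsilon\to0^+}\frac{\sum_{l\in\{0,\dots,k-1\}^I}\mu\big(T_\epsilon(H,\prod_i[\log B^{l_i},\log (B^{l_i}s_i)))\big)}{\mu\big(T_\epsilon(H,[0,k\log B)^I)\big)}=\prod_{i\in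 I}\int_1^{s_i}\frac{dx}{x\log B}.$$ 2. *(Joint law of the diagonal entries.)* Any $n-1$ of the diagonal entries of $g\in G$ follow jointly a product of $B$-Benford laws: for every $m\in\{1,\dots,n\}$, with $I=\{i: i\ne m\}$ and $H_i=E_{ii}-E_{mm}$ (so that $\exp(\sum_j t_jH_j)$ has $i$-th diagonal entry $e^{t_i}$ for $i\neq m$), and all $s\in[1,B)^I$, $$\lim_{k\to\infty}\lim_{\epsilon\to0^+}\frac{\mu\big(\{g\in T_\epsilon(H,[0,k\log B)^I)\,:\,S_B(g_{ii})\le s_i\ \forall i\ne m\}\big)}{\mu\big(T_\epsilon(H,[0,k\log B)^I)\big)}=\prod_{i\ne m}\int_1^{s_i}\frac{dx}{x\log B}=\prod_{i\ne m}\log_B s_i .$$ -/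

import Mathlib

open MeasureTheory Filter Topology Matrix

noncomputable section

/-- The group `SL_n(ℝ)`, with its usual topology (as a closed subset of the matrices). -/
abbrev SLn (n : ℕ) : Type := Matrix.SpecialLinearGroup (Fin n) ℝ

/-- `SL_n(ℝ)` carries its Borel σ-algebra. -/
instance instMeasurableSpaceSLn (n : ℕ) : MeasurableSpace (SLn n) := borel (SLn n)

instance instBorelSpaceSLn (n : ℕ) : BorelSpace (SLn n) := ⟨rfl⟩

/-! ### The coordinates `(X, Y, a) ↦ exp(X) exp(Y) a` -/

/-- Positions strictly below the diagonal. -/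
abbrev StrictLower (n : ℕ) : Type := {p : Fin n × Fin n // p.2 < p.1}

/-- Positions strictly above the diagonal. -/
abbrev StrictUpper (n : ℕ) : Type := {p : Fin n × Fin n // p.1 < p.2}

/-- The strictly lower triangular matrix `∑_{i > j} x_{ij} E_{ij}`. This identifies
`StrictLower n → ℝ`, with its Lebesgue measure `volume`, with the Lie algebra of the lower
unipotent group. -/
def lowerMatrix {n : ℕ} (x : StrictLower n → ℝ) : Matrix (Fin n) (Fin n) ℝ :=
  Matrix.of fun i j => if h : j < i then x ⟨(i, j), h⟩ else 0

/-- The strictly upper triangular matrix `∑_{i < j} y_{ij} E_{ij}`. This identifies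
`StrictUpper n → ℝ`, with its Lebesgue measure `volume`, with the Lie algebra of the upper
unipotent group. -/
def upperMatrix {n : ℕ} (y : StrictUpper n → ℝ) : Matrix (Fin n) (Fin n) ℝ :=
  Matrix.of fun i j => if h : i < j then y ⟨(i, j), h⟩ else 0

/-- The exponential of a strictly lower triangular matrix has determinant one. -/
theorem det_exp_of_strictLower {n : ℕ} (M : Matrix (Fin n) (Fin n) ℝ)
    (hM : ∀ i j, i ≤ j → M i j = 0) : (NormedSpace.exp M).det = 1 := by
  have hpow : ∀ k : ℕ, ∀ i j, i ≤ j → (M ^ (k + 1)) i j = 0 := by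
    intro k
    induction k with
    | zero => simpa using hM
    | succ k ih =>
      intro i j hij
      rw [pow_succ, Matrix.mul_apply]
      refine Finset.sum_eq_zero fun l _ => ?_
      rcases le_total i l with h | h
      · rw [ih i l h, zero_mul]
      · rw [hM l j (h.trans hij), mul_zero]
  have hsum : HasSum (fun k : ℕ => ((k.factorial : ℝ)⁻¹) • M ^ k) (NormedSpace.exp M) := by
    let _ : SeminormedRing (Matrix (Fin n) (Fin n) ℝ) := Matrix.linftyOpSemiNormedRing
    let _ : NormedRing (Matrix (Fin n) (Fin n) ℝ) := Matrix.linftyOpNormedRing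
    let _ : NormedAlgebra ℝ (Matrix (Fin n) (Fin n) ℝ) := Matrix.linftyOpNormedAlgebra
    exact NormedSpace.exp_series_hasSum_exp' (𝕂 := ℝ) M
  have hentry : ∀ i j, i ≤ j →
      NormedSpace.exp M i j = (1 : Matrix (Fin n) (Fin n) ℝ) i j := by
    intro i j hij
    have h1 : HasSum (fun k : ℕ => (((k.factorial : ℝ)⁻¹) • M ^ k) i j)
        (NormedSpace.exp M i j) := Pi.hasSum.1 (Pi.hasSum.1 hsum i) j
    have h2 := hasSum_single (f := fun k : ℕ => (((k.factorial : ℝ)⁻¹) • M ^ k) i j) 0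
      (by
        intro k hk
        obtain ⟨l, rfl⟩ := Nat.exists_eq_succ_of_ne_zero hk
        simp [hpow l i j hij])
    have h3 := h1.unique h2
    simpa using h3
  rw [Matrix.det_of_isLowerTriangular]
  · simp [hentry]
  · intro i j hij
    have hij' : i < j := by simpa using hij
    rw [hentry i j hij'.le, Matrix.one_apply_ne hij'.ne]

theorem det_exp_lowerMatrix {n : ℕ} (x : StrictLower n → ℝ) :
    (NormedSpace.exp (lowerMatrix x)).det = 1 :=
  det_exp_of_strictLower _ fun i j hij => by simp [lowerMatrix, not_lt.2 hij]

theorem det_exp_upperMatrix {n : ℕ} (y : StrictUpper n → ℝ) :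
    (NormedSpace.exp (upperMatrix y)).det = 1 := by
  rw [← Matrix.det_transpose, ← Matrix.exp_transpose]
  exact det_exp_of_strictLower _ fun i j hij => by simp [upperMatrix, not_lt.2 hij]

/-- `exp(X)` as an element of `SL_n(ℝ)`, for `X` strictly lower triangular. -/
def expLower {n : ℕ} (x : StrictLower n → ℝ) : SLn n :=
  ⟨NormedSpace.exp (lowerMatrix x), det_exp_lowerMatrix x⟩

/-- `exp(Y)` as an element of `SL_n(ℝ)`, for `Y` strictly upper triangular. -/
def expUpper {n : ℕ} (y : StrictUpper n → ℝ) : SLn n :=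
  ⟨NormedSpace.exp (upperMatrix y), det_exp_upperMatrix y⟩

/-- The group `D₁` of diagonal matrices of determinant one (the entries may have either sign). -/
def diagOne (n : ℕ) : Subgroup (SLn n) where
  carrier := {g | (g : Matrix (Fin n) (Fin n) ℝ).IsDiag}
  one_mem' := by simp
  mul_mem' := by
    intro a b ha hb i j hij
    have ha' : (a : Matrix (Fin n) (Fin n) ℝ).IsDiag := ha
    have hb' : (b : Matrix (Fin n) (Fin n) ℝ).IsDiag := hb
    rw [Matrix.SpecialLinearGroup.coe_mul, ← ha'.diagonal_diag, ← hb'.diagonal_diag,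
      Matrix.diagonal_mul_diagonal]
    exact Matrix.diagonal_apply_ne _ hij
  inv_mem' := by
    intro a ha
    have ha' : (a : Matrix (Fin n) (Fin n) ℝ).IsDiag := ha
    change ((a⁻¹ : SLn n) : Matrix (Fin n) (Fin n) ℝ).IsDiag
    rw [Matrix.SpecialLinearGroup.coe_inv, ← ha'.diagonal_diag, Matrix.adjugate_diagonal]
    exact Matrix.isDiag_diagonal _

/-- Indices of the first `n - 1` diagonal entries. -/
abbrev DiagIndex (n : ℕ) : Type := {i : Fin n // (i : ℕ) + 1 < n}

/-- The chart `a ↦ (a_{11}, …, a_{n-1,n-1})` of `D₁`, which identifies `D₁` with the open set of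
points of `ℝ^{n-1}` with no vanishing coordinate. -/
def diagChart (n : ℕ) (a : diagOne n) : DiagIndex n → ℝ :=
  fun i => (a : SLn n) i.1 i.1

/-- The measure `da = ∏_{i=1}^{n-1} da_{ii} / |a_{ii}|` on `D₁`, in the chart `diagChart`. -/
def diagMeasure (n : ℕ) : Measure (diagOne n) :=
  Measure.comap (diagChart n)
    ((volume : Measure (DiagIndex n → ℝ)).withDensity
      fun x => ∏ i, ENNReal.ofReal (|x i|⁻¹))

/-- The map `(X, Y, a) ↦ exp(X) exp(Y) a`. -/
def ludMap {n : ℕ} (x : StrictLower n → ℝ) (y : StrictUpper n → ℝ) (a : diagOne n) : SLn n :=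
  expLower x * expUpper y * (a : SLn n)

/-! ### Digit laws along commuting one-parameter subgroups -/

/-- The significand of `x` in base `B`: the number `S ∈ [1, B)` with `|x| = S * B ^ k`, `k ∈ ℤ`
(for `x ≠ 0` and `B > 1`). -/
def significand (B x : ℝ) : ℝ := |x| / B ^ ⌊Real.logb B |x|⌋

/-- The Benford density `1 / (x log B)` on `[1, B)`. -/
def benfordDensity (B : ℝ) (x : ℝ) : ℝ := 1 / (Real.log B * x)

/-- The tube of radius `ε` around `{exp(∑ tᵢ Hᵢ) : t ∈ J}` in `SL_n(ℝ)`: all products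
`exp(∑ tᵢ Hᵢ) exp(Y)` with `t ∈ J` and `Y` a traceless matrix orthogonal to every `Hᵢ` and of norm
less than `ε`, for the inner product `⟨X, Y⟩ = tr(Xᵀ Y)`. -/
def tube {n : ℕ} {ι : Type*} [Fintype ι] (H : ι → Matrix (Fin n) (Fin n) ℝ) (ε : ℝ)
    (J : Set (ι → ℝ)) : Set (SLn n) :=
  {g | ∃ t ∈ J, ∃ Y : Matrix (Fin n) (Fin n) ℝ, Y.trace = 0 ∧ (∀ i, ((H i)ᵀ * Y).trace = 0) ∧
    √((Yᵀ * Y).trace) < ε ∧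
    (g : Matrix (Fin n) (Fin n) ℝ) = NormedSpace.exp (∑ i, t i • H i) * NormedSpace.exp Y}

/-- The half-open cube `[0, k log B)^ι`. -/
def logCube (ι : Type*) (B : ℝ) (k : ℕ) : Set (ι → ℝ) :=
  {t | ∀ i, 0 ≤ t i ∧ t i < k * Real.log B}

/-- The cell `∏ᵢ [log B^{lᵢ}, log (B^{lᵢ} sᵢ))`. -/
def logCell {ι : Type*} (B : ℝ) (l : ι → ℕ) (s : ι → ℝ) : Set (ι → ℝ) :=
  {t | ∀ i, Real.log (B ^ l i) ≤ t i ∧ t i < Real.log (B ^ l i * s i)}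

/-- `lim_{k → ∞} lim_{ε → 0+} r k ε = p`. -/
def HasIteratedLimit (r : ℕ → ℝ → ℝ) (p : ℝ) : Prop :=
  ∃ q : ℕ → ℝ, (∀ k, 0 < k → Tendsto (r k) (𝓝[>] 0) (𝓝 (q k))) ∧ Tendsto q atTop (𝓝 p)

/-- Under `μ`, the numbers `e^{tᵢ}` have independent significands with densities `ψᵢ` along the
group `x(t) = exp(∑ tᵢ Hᵢ)`: for all `s ∈ [1, B)^ι`, the proportion of the tube over
`1 ≤ e^{tᵢ} < B^k` which lies over the cells where each `e^{tᵢ}` has significand less than `sᵢ`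
has iterated limit `∏ᵢ ∫_1^{sᵢ} ψᵢ`. -/
def HasJointDigitLaw {n : ℕ} {ι : Type*} [Fintype ι] [DecidableEq ι] (μ : Measure (SLn n)) (B : ℝ)
    (H : ι → Matrix (Fin n) (Fin n) ℝ) (ψ : ι → ℝ → ℝ) : Prop :=
  ∀ s : ι → ℝ, (∀ i, s i ∈ Set.Ico 1 B) →
    HasIteratedLimit
      (fun k ε => (∑ l : ι → Fin k, μ.real (tube H ε (logCell B (fun i => (l i : ℕ)) s))) /
        μ.real (tube H ε (logCube ι B k)))
      (∏ i, ∫ x in (1 : ℝ)..(s i), ψ i x)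

/-- The directions `E_{ii} - E_{mm}`, `i ≠ m`: along `x(t) = exp(∑ tᵢ (E_{ii} - E_{mm}))` the
`i`-th diagonal entry is `e^{tᵢ}`. -/
def diagDirection {n : ℕ} (m : Fin n) (i : {i : Fin n // i ≠ m}) : Matrix (Fin n) (Fin n) ℝ :=
  Matrix.single i.1 i.1 1 - Matrix.single m m 1

/-- Under `μ`, the diagonal entries `g_{ii}`, `i ≠ m`, of `g ∈ SL_n(ℝ)` have independent
significands with densities `ψᵢ`, on average over the tubes around
`{exp(∑ tᵢ (E_{ii} - E_{mm})) : t ∈ [0, k log B)^{n-1}}`. -/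
def HasDiagonalDigitLaw {n : ℕ} (μ : Measure (SLn n)) (B : ℝ) (m : Fin n)
    (ψ : {i : Fin n // i ≠ m} → ℝ → ℝ) : Prop :=
  ∀ s : {i : Fin n // i ≠ m} → ℝ, (∀ i, s i ∈ Set.Ico 1 B) →
    HasIteratedLimit
      (fun k ε =>
        μ.real {g | g ∈ tube (diagDirection m) ε (logCube _ B k) ∧
            ∀ i : {i : Fin n // i ≠ m}, significand B (g i.1 i.1) ≤ s i} /
          μ.real (tube (diagDirection m) ε (logCube _ B k)))
      (∏ i, ∫ x in (1 : ℝ)..(s i), ψ i x)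

end

open MeasureTheory Filter Topology Matrix
noncomputable section

/-! Write `n = m + 1`. Left invariance of `dX dY da` is invisible in the coordinates `exp(X) exp(Y)
a`, so the measure is compared with Lebesgue measure on all matrices. Let `d` be the diagonal matrix
with free entries `a₁, …, aₘ` and determinant `δ`. The map `(X, Y, a, δ) ↦ exp(X) exp(Y) d` is a
composite of two triangular substitutions, and its Jacobian is `|δ|^m ∏ |aᵢ|⁻¹`
(`lintegral_ludMatrix`). Dividing the last column by `δ` recovers `exp(X) exp(Y) a`. Hence `dX dY
da` is the image, under that division, of Lebesgue measure weighted by `1_{[1,2]}(δ) / |δ|^m`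
(`lintegral_ludMeasure`). Left multiplication by `g ∈ SL_n` preserves Lebesgue measure and `δ`, and
it commutes with column operations, so the image is left invariant. Fubini then gives the integral
formula.

For the digit laws, the map `(t, Y) ↦ exp(∑ tᵢ Hᵢ) exp(Y)` is injective for small `Y` and all `t`: a
coincidence is translated back to the identity, where the inverse function theorem applies, and
exponentials of real diagonal matrices return near `1` only for small matrices. Projecting Haar
measure on the tube to the parameter `t` therefore gives a locally finite translation invariant
measure on `ℝ^I`, that is, a nonzero multiple of Lebesgue measure (`exists_measure_tube_eq`). Ratios
of tube measures become ratios of volumes, and the first digit law is an exact count of cells. For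
the diagonal entries, `g_ii = exp(tᵢ + u)` with `u → 0` as `ε → 0`. The set in question is squeezed
between tubes over slightly shrunk and slightly enlarged cells (`diagonalDigit_bounds`). -/

/-! ### Triangular changes of variables -/

/-- Rescaling and translating one coordinate by functions of the other ones. -/
theorem lintegral_update_mul_add {ι : Type*} [Fintype ι] [DecidableEq ι] (p : ι)
    {c g : (ι → ℝ) → ℝ} (hc : Measurable c) (hg : Measurable g) (hc0 : ∀ x, c x ≠ 0)
    (hc' : ∀ x t, c (Function.update x p t) = c x) (hg' : ∀ x t, g (Function.update x p t) = g x)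
    {F : (ι → ℝ) → ENNReal} (hF : Measurable F) :
    ∫⁻ x, F (Function.update x p (c x * x p + g x)) * ENNReal.ofReal |c x| = ∫⁻ x, F x := by
  have hT : Measurable fun x : ι → ℝ => Function.update x p (c x * x p + g x) := by
    refine measurable_pi_iff.2 fun q => ?_
    by_cases hq : q = p
    · subst hq; simp only [Function.update_self]; fun_prop
    · simp only [Function.update_of_ne hq]; fun_prop
  rw [volume_pi]
  -- By Fubini it is enough to integrate over the coordinate `p` with the others frozen; there the
  -- map is affine with constant slope.
  refine lintegral_eq_of_lmarginal_eq {p} (by fun_prop) hF ?_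
  simp_rw [lmarginal_singleton]
  ext x
  simp only [hc', hg', Function.update_self, Function.update_idem]
  have hm : Measurable fun t : ℝ => F (Function.update x p t) := by fun_prop
  rw [lintegral_mul_const _ (by fun_prop), mul_comm]
  have h1 : ∫⁻ t : ℝ, F (Function.update x p (c x * t + g x)) =
      ∫⁻ t : ℝ, F (Function.update x p (t + g x)) ∂(Measure.map (c x * ·) volume) := by
    rw [lintegral_map (by fun_prop) (by fun_prop)]
  rw [h1, Real.map_volume_mul_left (hc0 x), lintegral_smul_measure, smul_eq_mul, ← mul_assoc,
    ← ENNReal.ofReal_mul (abs_nonneg _), ← abs_mul, mul_inv_cancel₀ (hc0 x)]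
  simp [lintegral_add_right_eq_self (μ := volume) fun t => F (Function.update x p t)]

/-- Change of variables for a triangular map: the coordinate `p` of the image is
`c p x * x p + g p x`, where `c p` and `g p` depend only on coordinates of smaller rank. -/
theorem lintegral_triangular {ι : Type*} [Fintype ι] (r : ι → ℕ)
    {c g : ι → (ι → ℝ) → ℝ} (hc : ∀ p, Measurable (c p)) (hg : ∀ p, Measurable (g p))
    (hc0 : ∀ p x, c p x ≠ 0)
    (hc' : ∀ p x y, (∀ q, r q < r p → x q = y q) → c p x = c p y)
    (hg' : ∀ p x y, (∀ q, r q < r p → x q = y q) → g p x = g p y)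
    {F : (ι → ℝ) → ENNReal} (hF : Measurable F) :
    ∫⁻ x, F (fun p => c p x * x p + g p x) * ∏ p, ENNReal.ofReal |c p x| = ∫⁻ x, F x := by
  classical
  -- Only the coordinates in `s` are substituted, and `s` grows by increasing rank. The new
  -- coordinate has maximal rank, so altering it first leaves `c p` and `g p` unchanged for the
  -- older `p`.
  suffices h : ∀ s : Finset ι,
      ∫⁻ x, F (fun p => if p ∈ s then c p x * x p + g p x else x p) *
        ∏ p ∈ s, ENNReal.ofReal |c p x| = ∫⁻ x, F x by
    simpa using h Finset.univ
  intro s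
  induction s using Finset.induction_on_max_value r with
  | empty => simp
  | insert a s ha hmax ih =>
    have hinv : ∀ p, r p ≤ r a → ∀ (x : ι → ℝ) (t : ℝ) (q : ι), r q < r p →
        Function.update x a t q = x q := by
      intro p hp x t q hq
      refine Function.update_of_ne ?_ _ _
      rintro rfl
      omega
    have hmeas : Measurable fun x : ι → ℝ =>
        F (fun p => if p ∈ s then c p x * x p + g p x else x p) *
          ∏ p ∈ s, ENNReal.ofReal |c p x| := by
      refine Measurable.mul (hF.comp (measurable_pi_iff.2 fun p => ?_)) ?_
      · by_cases hp : p ∈ s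
        · simp only [hp, if_true]; fun_prop
        · simp only [hp, if_false]; fun_prop
      · exact Finset.measurable_prod _ fun p _ => by fun_prop
    rw [← ih, ← lintegral_update_mul_add a (hc a) (hg a) (hc0 a)
      (fun x t => hc' a _ _ (hinv a le_rfl x t)) (fun x t => hg' a _ _ (hinv a le_rfl x t)) hmeas]
    refine lintegral_congr fun x => ?_
    set y := Function.update x a (c a x * x a + g a x) with hy
    have e1 : (fun p => if p ∈ insert a s then c p x * x p + g p x else x p) =
        fun p => if p ∈ s then c p y * y p + g p y else y p := by
      ext p
      by_cases hp : p = a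
      · subst hp; simp [ha, hy]
      · by_cases hps : p ∈ s
        · simp only [Finset.mem_insert, hp, hps, or_true, if_true]
          rw [hc' p y x (hinv p (hmax p hps) x _), hg' p y x (hinv p (hmax p hps) x _), hy,
            Function.update_of_ne hp]
        · simp [hp, hps, hy]
    have e2 : ∏ p ∈ s, ENNReal.ofReal |c p y| = ∏ p ∈ s, ENNReal.ofReal |c p x| :=
      Finset.prod_congr rfl fun p hp => by rw [hc' p y x (hinv p (hmax p hp) x _)]
    rw [Finset.prod_insert ha, e1, e2]
    ring

/-- `lintegral_triangular` for scaling factors that vanish only on a null set. -/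
theorem lintegral_triangular_ae {ι : Type*} [Fintype ι] (r : ι → ℕ)
    {c g : ι → (ι → ℝ) → ℝ} (hc : ∀ p, Measurable (c p)) (hg : ∀ p, Measurable (g p))
    (hc0 : ∀ p, ∀ᵐ x, c p x ≠ 0)
    (hc' : ∀ p x y, (∀ q, r q < r p → x q = y q) → c p x = c p y)
    (hg' : ∀ p x y, (∀ q, r q < r p → x q = y q) → g p x = g p y)
    {F : (ι → ℝ) → ENNReal} (hF : Measurable F) :
    ∫⁻ x, F (fun p => c p x * x p + g p x) * ∏ p, ENNReal.ofReal |c p x| = ∫⁻ x, F x := by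
  -- Replacing `c p` by `1` where it vanishes changes the integrand only on a null set.
  have key := lintegral_triangular r (c := fun p x => if c p x = 0 then 1 else c p x) (g := g)
    (fun p => Measurable.ite (hc p (measurableSet_singleton 0)) measurable_const (hc p)) hg
    (fun p x => by split_ifs with h; exacts [one_ne_zero, h])
    (fun p x y h => by simp only [hc' p x y h]) hg' hF
  rw [← key]
  refine lintegral_congr_ae ?_
  filter_upwards [ae_all_iff.2 hc0] with x hx
  simp [hx]

/-- A coordinate vanishes only on a Lebesgue null set. -/
theorem ae_coord_ne_zero {ι : Type*} [Fintype ι] (p : ι) : ∀ᵐ x : ι → ℝ, x p ≠ 0 := by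
  have h : (volume : Measure (ι → ℝ)) ((fun x => x p) ⁻¹' {0}) = 0 :=
    (Measure.quasiMeasurePreserving_eval _ p).preimage_null (by simp)
  exact measure_eq_zero_iff_ae_notMem.1 h

/-! ### Exponentials of strictly triangular matrices -/

theorem continuous_matrix_exp {m : Type*} [Fintype m] [DecidableEq m] :
    Continuous (NormedSpace.exp : Matrix m m ℝ → Matrix m m ℝ) := by
  let _ : NormedRing (Matrix m m ℝ) := Matrix.linftyOpNormedRing
  let _ : NormedAlgebra ℝ (Matrix m m ℝ) := Matrix.linftyOpNormedAlgebra
  let _ : NormedAlgebra ℚ (Matrix m m ℝ) := NormedAlgebra.restrictScalars ℚ ℝ _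
  exact NormedSpace.exp_continuous

theorem hasSum_matrix_exp_apply {m : Type*} [Fintype m] [DecidableEq m] (A : Matrix m m ℝ)
    (i j : m) :
    HasSum (fun k : ℕ => (k.factorial : ℝ)⁻¹ * (A ^ k) i j) (NormedSpace.exp A i j) := by
  have hsum : HasSum (fun k : ℕ => ((k.factorial : ℝ)⁻¹) • A ^ k) (NormedSpace.exp A) := by
    let _ : SeminormedRing (Matrix m m ℝ) := Matrix.linftyOpSemiNormedRing
    let _ : NormedRing (Matrix m m ℝ) := Matrix.linftyOpNormedRing
    let _ : NormedAlgebra ℝ (Matrix m m ℝ) := Matrix.linftyOpNormedAlgebra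
    exact NormedSpace.exp_series_hasSum_exp' (𝕂 := ℝ) A
  exact Pi.hasSum.1 (Pi.hasSum.1 hsum i) j

/-- The height `h` treats both triangular shapes at once: `h i = i` gives strictly lower matrices,
`h i = -i` strictly upper ones. -/
theorem pow_succ_apply_eq_zero_of_strict {m : Type*} [Fintype m] [DecidableEq m] (h : m → ℤ)
    {A : Matrix m m ℝ} (hA : ∀ i j, h i ≤ h j → A i j = 0) (k : ℕ) :
    ∀ i j, h i ≤ h j → (A ^ (k + 1)) i j = 0 := by
  induction k with
  | zero => simpa using hA
  | succ k ih =>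
    intro i j hij
    rw [pow_succ, Matrix.mul_apply]
    refine Finset.sum_eq_zero fun l _ => ?_
    rcases le_total (h i) (h l) with hl | hl
    · rw [ih i l hl, zero_mul]
    · rw [hA l j (hl.trans hij), mul_zero]

theorem exp_apply_eq_one_of_strict {m : Type*} [Fintype m] [DecidableEq m] (h : m → ℤ)
    {A : Matrix m m ℝ} (hA : ∀ i j, h i ≤ h j → A i j = 0) {i j : m} (hij : h i ≤ h j) :
    NormedSpace.exp A i j = (1 : Matrix m m ℝ) i j := by
  have h2 := hasSum_single (f := fun k : ℕ => (k.factorial : ℝ)⁻¹ * (A ^ k) i j) 0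
    (by
      intro k hk
      obtain ⟨l, rfl⟩ := Nat.exists_eq_succ_of_ne_zero hk
      simp [pow_succ_apply_eq_zero_of_strict h hA l i j hij])
  simpa using (hasSum_matrix_exp_apply A i j).unique h2

/-- A product of at least two strictly triangular factors splits the height drop `h i - h j` into
positive pieces, each smaller than the total. Thus entries with drop below `r` determine these
powers up to drop `r` inclusive. -/
theorem pow_add_two_apply_congr {m : Type*} [Fintype m] [DecidableEq m] (h : m → ℤ)
    {A A' : Matrix m m ℝ} (hA : ∀ i j, h i ≤ h j → A i j = 0)
    (hA' : ∀ i j, h i ≤ h j → A' i j = 0) {r : ℤ}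
    (heq : ∀ i j, h i - h j < r → A i j = A' i j) (k : ℕ) :
    ∀ i j, h i - h j ≤ r → (A ^ (k + 2)) i j = (A' ^ (k + 2)) i j := by
  have step : ∀ k, (∀ i j, h i - h j < r → (A ^ (k + 1)) i j = (A' ^ (k + 1)) i j) →
      ∀ i j, h i - h j ≤ r → (A ^ (k + 2)) i j = (A' ^ (k + 2)) i j := by
    intro k hk i j hij
    rw [pow_succ A (k + 1), pow_succ A' (k + 1), Matrix.mul_apply, Matrix.mul_apply]
    refine Finset.sum_congr rfl fun l _ => ?_
    rcases le_or_gt (h i) (h l) with hl | hl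
    · rw [pow_succ_apply_eq_zero_of_strict h hA k i l hl,
        pow_succ_apply_eq_zero_of_strict h hA' k i l hl, zero_mul, zero_mul]
    rcases le_or_gt (h l) (h j) with hj | hj
    · rw [hA l j hj, hA' l j hj, mul_zero, mul_zero]
    · rw [hk i l (by linarith), heq l j (by linarith)]
  refine step k ?_
  induction k with
  | zero => simpa using heq
  | succ k ih => exact fun i j hij => step k ih i j hij.le

/-- For a strictly triangular matrix `A`, the entry `exp A i j - A i j` depends only on the entries
of `A` closer to the diagonal. -/
theorem exp_apply_sub_congr {m : Type*} [Fintype m] [DecidableEq m] (h : m → ℤ)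
    {A A' : Matrix m m ℝ} (hA : ∀ i j, h i ≤ h j → A i j = 0)
    (hA' : ∀ i j, h i ≤ h j → A' i j = 0) {r : ℤ}
    (heq : ∀ i j, h i - h j < r → A i j = A' i j) {i j : m} (hij : h i - h j ≤ r) :
    NormedSpace.exp A i j - A i j = NormedSpace.exp A' i j - A' i j := by
  have h1 := (hasSum_matrix_exp_apply A i j).sub (hasSum_matrix_exp_apply A' i j)
  -- In the difference of the two exponential series the terms `k = 0` and `k ≥ 2` cancel, leaving
  -- `A i j - A' i j`.
  have h2 := hasSum_single (f := fun k : ℕ =>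
    (k.factorial : ℝ)⁻¹ * (A ^ k) i j - (k.factorial : ℝ)⁻¹ * (A' ^ k) i j) 1
    (by
      intro k hk
      match k with
      | 0 => simp
      | 1 => exact absurd rfl hk
      | k + 2 => simp [pow_add_two_apply_congr h hA hA' heq k i j hij])
  have h3 := h1.unique h2
  simp only [Nat.factorial_one, Nat.cast_one, inv_one, pow_one, one_mul] at h3
  linarith

theorem exp_lowerMatrix_apply_of_le {n : ℕ} (x : StrictLower n → ℝ) {i j : Fin n} (hij : i ≤ j) :
    NormedSpace.exp (lowerMatrix x) i j = (1 : Matrix (Fin n) (Fin n) ℝ) i j :=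
  exp_apply_eq_one_of_strict (fun i : Fin n => ((i : ℕ) : ℤ))
    (fun i j h => by
      have : i ≤ j := by simpa using h
      simp [lowerMatrix, not_lt.2 this]) (by simpa using hij)

theorem exp_upperMatrix_apply_of_le {n : ℕ} (y : StrictUpper n → ℝ) {i j : Fin n} (hij : j ≤ i) :
    NormedSpace.exp (upperMatrix y) i j = (1 : Matrix (Fin n) (Fin n) ℝ) i j :=
  exp_apply_eq_one_of_strict (fun i : Fin n => -((i : ℕ) : ℤ))
    (fun i j h => by
      have : j ≤ i := by simpa using h
      simp [upperMatrix, not_lt.2 this]) (by simpa using hij)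

/-! ### The LU decomposition as a change of variables -/

/-- The strictly lower triangular part of a family of matrix entries. -/
def lowerPart {n : ℕ} (z : Fin n × Fin n → ℝ) : StrictLower n → ℝ := fun p => z p.1

/-- The strictly upper triangular part of a family of matrix entries. -/
def upperPart {n : ℕ} (z : Fin n × Fin n → ℝ) : StrictUpper n → ℝ := fun p => z p.1

/-- The entries of a matrix, as a point of `ℝ^(n × n)`. -/
def entries {n : ℕ} (M : Matrix (Fin n) (Fin n) ℝ) : Fin n × Fin n → ℝ := fun p => M p.1 p.2

/-- The product of the unit lower triangular matrix and of the upper triangular matrix whose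
entries are given by `x`. -/
def unitLowerMul {n : ℕ} (x : Fin n × Fin n → ℝ) : Matrix (Fin n) (Fin n) ℝ :=
  (Matrix.of fun i j => if j < i then x (i, j) else (1 : Matrix (Fin n) (Fin n) ℝ) i j) *
    Matrix.of fun i j => if i ≤ j then x (i, j) else 0

/-- Isolating the index `k = min i j` exhibits the triangular form: its coefficient is the unit
diagonal entry of `L` on or above the diagonal, and the pivot `x (j, j)` below it. -/
theorem unitLowerMul_apply {n : ℕ} (x : Fin n × Fin n → ℝ) (i j : Fin n) :
    unitLowerMul x i j = (if j < i then x (j, j) else 1) * x (i, j) +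
      ∑ k ∈ Finset.Iio (min i j), x (i, k) * x (k, j) := by
  rw [unitLowerMul, Matrix.mul_apply, ← Finset.sum_subset (Finset.subset_univ (Finset.Iic (min i j))),
    ← Finset.Iio_insert, Finset.sum_insert (by simp)]
  · congr 1
    · rcases lt_or_ge j i with h | h
      · simp [h, min_eq_right h.le, mul_comm]
      · simp [h, not_lt.2 h]
    · refine Finset.sum_congr rfl fun k hk => ?_
      have hk' : k < i ∧ k < j := by simpa using hk
      simp [hk'.1, hk'.2.le]
  · intro k _ hk
    simp only [Finset.mem_Iic, le_min_iff, not_and_or, not_le] at hk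
    rcases hk with hk | hk
    · simp [not_lt.2 hk.le, Matrix.one_apply_ne hk.ne]
    · simp [not_le.2 hk]

/-- The rank follows elimination: row `k` of `U` has rank `2k` and column `k` of `L` has rank `2k +
1`. The pivot of a column thus precedes its subdiagonal entries, and the sum over `k < min i j` uses
earlier stages only. -/
theorem lintegral_unitLowerMul {n : ℕ} {F : (Fin n × Fin n → ℝ) → ENNReal} (hF : Measurable F) :
    ∫⁻ x, F (entries (unitLowerMul x)) *
      ∏ p : Fin n × Fin n, ENNReal.ofReal |if p.2 < p.1 then x (p.2, p.2) else 1| =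
    ∫⁻ x, F x := by
  rw [← lintegral_triangular_ae
    (fun p : Fin n × Fin n => 2 * (min p.1 p.2 : Fin n).val + if p.2 < p.1 then 1 else 0)
    (c := fun p x => if p.2 < p.1 then x (p.2, p.2) else 1)
    (g := fun p x => ∑ k ∈ Finset.Iio (min p.1 p.2), x (p.1, k) * x (k, p.2)) ?_ ?_ ?_ ?_ ?_ hF]
  · refine lintegral_congr fun x => ?_
    congr 2
    ext p
    exact unitLowerMul_apply x p.1 p.2
  · intro p
    by_cases h : p.2 < p.1 <;> simp only [h, if_true, if_false] <;> fun_prop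
  · intro p; fun_prop
  · intro p
    by_cases h : p.2 < p.1
    · simpa only [h, if_true] using ae_coord_ne_zero _
    · simp [h]
  · rintro ⟨i, j⟩ x y h
    by_cases hij : j < i
    · simp only [hij, if_true]
      refine h _ ?_
      simp [hij, min_eq_right hij.le]
    · simp [hij]
  · rintro ⟨i, j⟩ x y h
    refine Finset.sum_congr rfl fun k hk => ?_
    have hk' : k < min i j := by simpa using hk
    have hki : k < i := hk'.trans_le (min_le_left _ _)
    have hkj : k < j := hk'.trans_le (min_le_right _ _)
    have hlt : (k : ℕ) < (min i j : Fin n).val := hk'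
    rw [h (i, k), h (k, j)]
    · simp only [min_eq_left hkj.le, not_lt.2 hkj.le, if_false]
      omega
    · simp only [min_eq_right hki.le, hki, if_true]
      omega

/-- The diagonal entries `(a₁, …, aₘ, δ / (a₁ ⋯ aₘ))` with product `δ`. -/
def diagVec {m : ℕ} (a : DiagIndex (m + 1) → ℝ) (δ : ℝ) : Fin (m + 1) → ℝ :=
  fun j => if h : (j : ℕ) + 1 < m + 1 then a ⟨j, h⟩ else (∏ i, a i)⁻¹ * δ

/-- The first diagonal entries of a family of matrix entries. -/
def diagPart {m : ℕ} (z : Fin (m + 1) × Fin (m + 1) → ℝ) : DiagIndex (m + 1) → ℝ :=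
  fun i => z (i.1, i.1)

theorem prod_fin_eq_prod_diagIndex_mul_last {M : Type*} [CommMonoid M] {m : ℕ}
    (f : Fin (m + 1) → M) : ∏ j, f j = (∏ i : DiagIndex (m + 1), f i.1) * f (Fin.last m) := by
  rw [Fin.prod_univ_castSucc]
  congr 1
  refine Fintype.prod_bijective (fun i : Fin m => (⟨i.castSucc, by simp⟩ : DiagIndex (m + 1)))
    ⟨fun i j h => ?_, fun i => ?_⟩ _ _ fun _ => rfl
  · simpa [Fin.ext_iff] using h
  · exact ⟨⟨i.1, by have := i.2; omega⟩, by simp⟩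

theorem diagVec_diagIndex {m : ℕ} (a : DiagIndex (m + 1) → ℝ) (δ : ℝ) (i : DiagIndex (m + 1)) :
    diagVec a δ i.1 = a i := by
  simp only [diagVec, dif_pos i.2]

theorem diagVec_last {m : ℕ} (a : DiagIndex (m + 1) → ℝ) (δ : ℝ) :
    diagVec a δ (Fin.last m) = (∏ i, a i)⁻¹ * δ := by
  simp [diagVec]

theorem prod_diagVec {m : ℕ} {a : DiagIndex (m + 1) → ℝ} (ha : ∀ i, a i ≠ 0) (δ : ℝ) :
    ∏ j, diagVec a δ j = δ := by
  rw [prod_fin_eq_prod_diagIndex_mul_last, diagVec_last]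
  simp only [diagVec_diagIndex]
  rw [← mul_assoc, mul_inv_cancel₀ (Finset.prod_ne_zero_iff.2 fun i _ => ha i), one_mul]

theorem measurable_diagVec {m : ℕ} (j : Fin (m + 1)) :
    Measurable fun p : (DiagIndex (m + 1) → ℝ) × ℝ => diagVec p.1 p.2 j := by
  unfold diagVec
  by_cases h : (j : ℕ) + 1 < m + 1 <;> simp only [h, dif_pos, dif_neg, not_false_eq_true] <;>
    fun_prop

theorem continuous_lowerMatrix {n : ℕ} : Continuous (lowerMatrix (n := n)) := by
  refine continuous_matrix fun i j => ?_
  by_cases h : j < i <;> simp only [lowerMatrix, of_apply, h, dif_pos, dif_neg, not_false_eq_true] <;>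
    fun_prop

theorem continuous_upperMatrix {n : ℕ} : Continuous (upperMatrix (n := n)) := by
  refine continuous_matrix fun i j => ?_
  by_cases h : i < j <;> simp only [upperMatrix, of_apply, h, dif_pos, dif_neg, not_false_eq_true] <;>
    fun_prop

theorem continuous_lowerPart {n : ℕ} : Continuous (lowerPart (n := n)) := by
  unfold lowerPart; fun_prop

theorem continuous_upperPart {n : ℕ} : Continuous (upperPart (n := n)) := by
  unfold upperPart; fun_prop

theorem measurable_diagPart {m : ℕ} : Measurable (diagPart (m := m)) := by
  unfold diagPart; fun_prop

/-- The diagonal entries with product `z (last, last)`. -/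
def fullDiag {m : ℕ} (z : Fin (m + 1) × Fin (m + 1) → ℝ) : Fin (m + 1) → ℝ :=
  diagVec (diagPart z) (z (Fin.last m, Fin.last m))

theorem measurable_fullDiag {m : ℕ} (j : Fin (m + 1)) :
    Measurable fun z : Fin (m + 1) × Fin (m + 1) → ℝ => fullDiag z j :=
  (measurable_diagVec j).comp
    (measurable_diagPart.prodMk (measurable_pi_apply (Fin.last m, Fin.last m)))

theorem fullDiag_ne_zero {m : ℕ} {z : Fin (m + 1) × Fin (m + 1) → ℝ} (hz : ∀ p, z p ≠ 0)
    (j : Fin (m + 1)) : fullDiag z j ≠ 0 := by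
  unfold fullDiag diagVec
  split_ifs with h
  · exact hz _
  · exact mul_ne_zero (inv_ne_zero (Finset.prod_ne_zero_iff.2 fun i _ => hz _)) (hz _)

/-- The matrix `exp(X) exp(Y) d` in terms of its coordinates. -/
def ludMatrix {m : ℕ} (z : Fin (m + 1) × Fin (m + 1) → ℝ) :
    Matrix (Fin (m + 1)) (Fin (m + 1)) ℝ :=
  NormedSpace.exp (lowerMatrix (lowerPart z)) * NormedSpace.exp (upperMatrix (upperPart z)) *
    diagonal (fullDiag z)

/-- The scaling factors of the change of variables `ludCoord`. -/
def ludScale {m : ℕ} (p : Fin (m + 1) × Fin (m + 1)) (z : Fin (m + 1) × Fin (m + 1) → ℝ) : ℝ :=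
  if p.1 < p.2 then fullDiag z p.2 else
    if p = (Fin.last m, Fin.last m) then (∏ i, diagPart z i)⁻¹ else 1

/-- The translation part of the change of variables `ludCoord`. -/
def ludShift {m : ℕ} (p : Fin (m + 1) × Fin (m + 1)) (z : Fin (m + 1) × Fin (m + 1) → ℝ) : ℝ :=
  if p.1 < p.2 then
    fullDiag z p.2 * (NormedSpace.exp (upperMatrix (upperPart z)) p.1 p.2 - z p) else
    if p.2 < p.1 then NormedSpace.exp (lowerMatrix (lowerPart z)) p.1 p.2 - z p else 0

/-- The entries of the LU decomposition of `ludMatrix z`. -/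
def ludCoord {m : ℕ} (z : Fin (m + 1) × Fin (m + 1) → ℝ) : Fin (m + 1) × Fin (m + 1) → ℝ :=
  fun p => ludScale p z * z p + ludShift p z

theorem ludCoord_diag {m : ℕ} (z : Fin (m + 1) × Fin (m + 1) → ℝ) (j : Fin (m + 1)) :
    ludCoord z (j, j) = fullDiag z j := by
  by_cases hj : j = Fin.last m
  · subst hj; simp [ludCoord, ludScale, ludShift, fullDiag, diagVec_last]
  · have : (j : ℕ) + 1 < m + 1 := by
      have := Fin.val_lt_last hj; omega
    simp [ludCoord, ludScale, ludShift, fullDiag, diagVec, hj, this, diagPart]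

theorem ludCoord_upper {m : ℕ} (z : Fin (m + 1) × Fin (m + 1) → ℝ) {i j : Fin (m + 1)}
    (hij : i < j) : ludCoord z (i, j) =
      NormedSpace.exp (upperMatrix (upperPart z)) i j * fullDiag z j := by
  simp only [ludCoord, ludScale, ludShift, hij, if_true]
  ring

theorem ludCoord_lower {m : ℕ} (z : Fin (m + 1) × Fin (m + 1) → ℝ) {i j : Fin (m + 1)}
    (hij : j < i) : ludCoord z (i, j) = NormedSpace.exp (lowerMatrix (lowerPart z)) i j := by
  have h : ¬ ((i, j) = (Fin.last m, Fin.last m)) := by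
    rintro h; rw [Prod.mk.injEq] at h; exact hij.ne (h.2.trans h.1.symm)
  simp [ludCoord, ludScale, ludShift, hij, not_lt.2 hij.le, h]

/-- `exp X` is unit lower triangular and `exp(Y) d` is upper triangular with diagonal `d`, so these
are the two factors encoded by `ludCoord z`. -/
theorem unitLowerMul_ludCoord {m : ℕ} (z : Fin (m + 1) × Fin (m + 1) → ℝ) :
    unitLowerMul (ludCoord z) = ludMatrix z := by
  rw [unitLowerMul, ludMatrix, mul_assoc]
  congr 1
  · ext i j
    rw [of_apply]
    split_ifs with h
    · exact ludCoord_lower z h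
    · rw [exp_lowerMatrix_apply_of_le _ (not_lt.1 h)]
  · ext i j
    rw [of_apply, mul_diagonal]
    split_ifs with h
    · rcases h.lt_or_eq with h | rfl
      · exact ludCoord_upper z h
      · rw [ludCoord_diag, exp_upperMatrix_apply_of_le _ le_rfl, one_apply_eq, one_mul]
    · rw [exp_upperMatrix_apply_of_le _ (not_le.1 h).le, one_apply_ne (not_le.1 h).ne', zero_mul]

theorem measurable_ludScale {m : ℕ} (p : Fin (m + 1) × Fin (m + 1)) : Measurable (ludScale p) := by
  have h1 := measurable_fullDiag p.2
  have h2 : Measurable fun z : Fin (m + 1) × Fin (m + 1) → ℝ => (∏ i, diagPart z i)⁻¹ :=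
    (Finset.measurable_prod _ fun i _ => measurable_pi_apply (i.1, i.1)).inv
  unfold ludScale
  split_ifs
  exacts [h1, h2, measurable_const]

theorem measurable_ludShift {m : ℕ} (p : Fin (m + 1) × Fin (m + 1)) : Measurable (ludShift p) := by
  have h1 := measurable_fullDiag p.2
  have h2 : Measurable fun z : Fin (m + 1) × Fin (m + 1) → ℝ =>
      NormedSpace.exp (upperMatrix (upperPart z)) p.1 p.2 :=
    ((continuous_matrix_exp.comp (continuous_upperMatrix.comp continuous_upperPart)).matrix_elem
      p.1 p.2).measurable
  have h3 : Measurable fun z : Fin (m + 1) × Fin (m + 1) → ℝ =>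
      NormedSpace.exp (lowerMatrix (lowerPart z)) p.1 p.2 :=
    ((continuous_matrix_exp.comp (continuous_lowerMatrix.comp continuous_lowerPart)).matrix_elem
      p.1 p.2).measurable
  unfold ludShift
  split_ifs
  exacts [h1.mul (h2.sub (measurable_pi_apply p)), h3.sub (measurable_pi_apply p), measurable_const]

theorem lintegral_ludCoord {m : ℕ} {F : (Fin (m + 1) × Fin (m + 1) → ℝ) → ENNReal}
    (hF : Measurable F) :
    ∫⁻ z, F (ludCoord z) * ∏ p, ENNReal.ofReal |ludScale p z| = ∫⁻ x, F x := by
  -- Free diagonal entries come first, then the determinant slot, then off-diagonal positions by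
  -- distance to the diagonal. One of the two truncated differences is always zero, so their sum is
  -- `|i - j|`.
  let r : Fin (m + 1) × Fin (m + 1) → ℕ := fun p =>
    if p.1 = p.2 then (if p.1 = Fin.last m then 1 else 0) else 2 + (p.1.val - p.2) + (p.2.val - p.1)
  have hr0 : ∀ i : DiagIndex (m + 1), r (i.1, i.1) = 0 := fun i => by
    have : i.1 ≠ Fin.last m := fun h => by have := i.2; rw [h] at this; simp at this
    simp [r, this]
  have hr1 : r (Fin.last m, Fin.last m) = 1 := by simp [r]
  have hr2 : ∀ p : Fin (m + 1) × Fin (m + 1), p.1 ≠ p.2 →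
      r p = 2 + (p.1.val - p.2) + (p.2.val - p.1) := fun p hp => by simp [r, hp]
  have hdiag : ∀ x y : Fin (m + 1) × Fin (m + 1) → ℝ, ∀ k, 1 ≤ k → (∀ q, r q < k → x q = y q) →
      diagPart x = diagPart y := fun x y k hk h => funext fun i => h _ (by rw [hr0]; omega)
  have hfull : ∀ x y : Fin (m + 1) × Fin (m + 1) → ℝ, ∀ k, 2 ≤ k → (∀ q, r q < k → x q = y q) →
      fullDiag x = fullDiag y := fun x y k hk h => by
    rw [fullDiag, fullDiag, hdiag x y k (by omega) h, h _ (by rw [hr1]; omega)]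
  refine lintegral_triangular_ae r measurable_ludScale measurable_ludShift ?_ ?_ ?_ hF
  · intro p
    filter_upwards [ae_all_iff.2 (ae_coord_ne_zero (ι := Fin (m + 1) × Fin (m + 1)))] with z hz
    unfold ludScale
    split_ifs
    exacts [fullDiag_ne_zero hz _, inv_ne_zero (Finset.prod_ne_zero_iff.2 fun i _ => hz _),
      one_ne_zero]
  · intro p x y h
    unfold ludScale
    split_ifs with h1 h2
    · rw [hfull x y _ (by rw [hr2 p h1.ne]; omega) h]
    · rw [hdiag x y _ (by rw [h2, hr1]) h]
    · rfl
  · rintro ⟨i, j⟩ x y h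
    unfold ludShift
    dsimp only
    split_ifs with h1 h2
    · rw [hfull x y _ (by rw [hr2 _ h1.ne]; omega) h]
      congr 1
      have e := exp_apply_sub_congr (fun i : Fin (m + 1) => -((i : ℕ) : ℤ))
        (A := upperMatrix (upperPart x)) (A' := upperMatrix (upperPart y))
        (fun i j hij => by
          have : j ≤ i := by simpa using hij
          simp [upperMatrix, not_lt.2 this])
        (fun i j hij => by
          have : j ≤ i := by simpa using hij
          simp [upperMatrix, not_lt.2 this]) (r := (j : ℤ) - i)
        (fun i' j' hij => by
          by_cases hl : i' < j'
          · have hl' : (i' : ℕ) < j' := hl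
            have h1' : (i : ℕ) < j := h1
            simp only [upperMatrix, of_apply, hl, dif_pos, upperPart]
            refine h _ ?_
            rw [hr2 _ hl.ne, hr2 _ h1.ne]
            dsimp only
            omega
          · simp [upperMatrix, hl]) (i := i) (j := j) (by omega)
      simpa [upperMatrix, h1, upperPart] using e
    · have e := exp_apply_sub_congr (fun i : Fin (m + 1) => ((i : ℕ) : ℤ))
        (A := lowerMatrix (lowerPart x)) (A' := lowerMatrix (lowerPart y))
        (fun i j hij => by
          have : i ≤ j := by simpa using hij
          simp [lowerMatrix, not_lt.2 this])
        (fun i j hij => by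
          have : i ≤ j := by simpa using hij
          simp [lowerMatrix, not_lt.2 this]) (r := (i : ℤ) - j)
        (fun i' j' hij => by
          by_cases hl : j' < i'
          · have hl' : (j' : ℕ) < i' := hl
            have h2' : (j : ℕ) < i := h2
            simp only [lowerMatrix, of_apply, hl, dif_pos, lowerPart]
            refine h _ ?_
            rw [hr2 _ hl.ne', hr2 _ h2.ne']
            dsimp only
            omega
          · simp [lowerMatrix, hl]) (i := i) (j := j) (by omega)
      simpa [lowerMatrix, h2, lowerPart] using e
    · rfl

/-- This collects the Jacobian: each `d_j` occurs once for every off-diagonal position of column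
`j`, hence `m` times, and `∏ d_j` is the determinant. -/
theorem prod_offDiag_snd {m : ℕ} (f : Fin (m + 1) → ENNReal) :
    ∏ p : Fin (m + 1) × Fin (m + 1), (if p.1 = p.2 then 1 else f p.2) = (∏ j, f j) ^ m := by
  rw [Fintype.prod_prod_type_right, ← Finset.prod_pow]
  refine Finset.prod_congr rfl fun j _ => ?_
  simp only [Finset.prod_ite, Finset.prod_const_one, one_mul, Finset.prod_const]
  congr 1
  rw [Finset.filter_ne']
  simp

/-- Lebesgue measure on matrices in the coordinates `exp(X) exp(Y) d`, where `d` is parametrized by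
its first entries and its determinant. -/
theorem lintegral_ludMatrix {m : ℕ} {F : (Fin (m + 1) × Fin (m + 1) → ℝ) → ENNReal}
    (hF : Measurable F) :
    ∫⁻ z, F (entries (ludMatrix z)) * (ENNReal.ofReal |z (Fin.last m, Fin.last m)| ^ m *
      ∏ i, ENNReal.ofReal |diagPart z i|⁻¹) = ∫⁻ x, F x := by
  have hU : Measurable fun x : Fin (m + 1) × Fin (m + 1) → ℝ => entries (unitLowerMul x) := by
    refine measurable_pi_iff.2 fun p => ?_
    simp only [entries, unitLowerMul_apply]
    by_cases h : p.2 < p.1 <;> simp only [h, if_true, if_false] <;> fun_prop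
  have hW : Measurable fun x : Fin (m + 1) × Fin (m + 1) → ℝ =>
      ∏ p : Fin (m + 1) × Fin (m + 1), ENNReal.ofReal |if p.2 < p.1 then x (p.2, p.2) else 1| := by
    refine Finset.measurable_prod _ fun p _ => ?_
    by_cases h : p.2 < p.1 <;> simp only [h, if_true, if_false] <;> fun_prop
  refine Eq.trans ?_ ((lintegral_ludCoord ((hF.comp hU).mul hW)).trans (lintegral_unitLowerMul hF))
  refine lintegral_congr_ae ?_
  filter_upwards [ae_all_iff.2 (ae_coord_ne_zero (ι := Fin (m + 1) × Fin (m + 1)))] with z hz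
  simp only [Pi.mul_apply, Function.comp_apply, unitLowerMul_ludCoord, ludCoord_diag]
  rw [mul_assoc, ← Finset.prod_mul_distrib]
  congr 1
  have hd : ∏ j, ENNReal.ofReal |fullDiag z j| =
      ENNReal.ofReal |z (Fin.last m, Fin.last m)| := by
    rw [← ENNReal.ofReal_prod_of_nonneg fun _ _ => abs_nonneg _, ← Finset.abs_prod, fullDiag,
      prod_diagVec (a := diagPart z) fun i => hz _]
  have hs : (∏ i, ENNReal.ofReal |diagPart z i|⁻¹) =
      ∏ p : Fin (m + 1) × Fin (m + 1), if p = (Fin.last m, Fin.last m) then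
        ENNReal.ofReal |(∏ i, diagPart z i)⁻¹| else 1 := by
    rw [Finset.prod_ite_eq' Finset.univ (Fin.last m, Fin.last m), if_pos (Finset.mem_univ _),
      ← ENNReal.ofReal_prod_of_nonneg fun _ _ => inv_nonneg.2 (abs_nonneg _), Finset.prod_inv_distrib,
      abs_inv, Finset.abs_prod]
  -- Factors are matched position by position: above the diagonal `d_j` comes from `ludScale`, below
  -- it from the pivot of the LU product, and the last diagonal position carries `(∏ aᵢ)⁻¹`.
  rw [← hd, ← prod_offDiag_snd, hs, ← Finset.prod_mul_distrib]
  refine Finset.prod_congr rfl fun p _ => ?_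
  obtain ⟨i, j⟩ := p
  rcases lt_trichotomy i j with h | rfl | h
  · have : ¬ ((i, j) = (Fin.last m, Fin.last m)) := by
      rintro h'; rw [Prod.mk.injEq] at h'; exact h.ne (h'.1.trans h'.2.symm)
    simp [ludScale, h, not_lt.2 h.le, h.ne, this]
  · simp only [ludScale, lt_irrefl, if_true, if_false, abs_one, ENNReal.ofReal_one, one_mul]
    split_ifs <;> simp
  · have : ¬ ((i, j) = (Fin.last m, Fin.last m)) := by
      rintro h'; rw [Prod.mk.injEq] at h'; exact h.ne (h'.2.trans h'.1.symm)
    simp [ludScale, h, not_lt.2 h.le, h.ne', this]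

/-! ### Topology and measurable structure of `SL_n(ℝ)` -/

theorem continuous_entries {n : ℕ} : Continuous (entries (n := n)) := by
  unfold entries; fun_prop

/-- The matrices with entries indexed by pairs. -/
def entriesHomeomorph (n : ℕ) : Matrix (Fin n) (Fin n) ℝ ≃ₜ (Fin n × Fin n → ℝ) where
  toFun := entries
  invFun x := Matrix.of fun i j => x (i, j)
  left_inv _ := rfl
  right_inv _ := rfl
  continuous_toFun := continuous_entries
  continuous_invFun := continuous_matrix fun i j => by simp only [of_apply]; fun_prop

/-- Topological and measurability properties of `SL_n(ℝ)` are transported through this embedding. -/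
theorem isClosedEmbedding_entries_SLn (n : ℕ) :
    IsClosedEmbedding fun g : SLn n => entries (g : Matrix (Fin n) (Fin n) ℝ) :=
  (entriesHomeomorph n).isClosedEmbedding.comp Matrix.SpecialLinearGroup.isClosedEmbedding_val

instance instPolishSpaceSLn (n : ℕ) : PolishSpace (SLn n) :=
  (isClosedEmbedding_entries_SLn n).polishSpace

instance instLocallyCompactSpaceSLn (n : ℕ) : LocallyCompactSpace (SLn n) :=
  (isClosedEmbedding_entries_SLn n).locallyCompactSpace

theorem measurable_SLn_iff {n : ℕ} {α : Type*} [MeasurableSpace α] {f : α → SLn n} :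
    Measurable f ↔ ∀ i j, Measurable fun x => (f x : Matrix (Fin n) (Fin n) ℝ) i j := by
  rw [← (isClosedEmbedding_entries_SLn n).measurableEmbedding.measurable_comp_iff,
    measurable_pi_iff, Prod.forall]
  rfl

/-! ### Haar measure on the diagonal group -/

theorem isClosed_diagOne (n : ℕ) : IsClosed (diagOne n : Set (SLn n)) := by
  have : (diagOne n : Set (SLn n)) =
      ⋂ (i : Fin n) (j : Fin n) (_ : i ≠ j),
        {g : SLn n | (g : Matrix (Fin n) (Fin n) ℝ) i j = 0} := by
    ext g
    simp only [Set.mem_iInter]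
    exact ⟨fun h i j hij => h hij, fun h i j hij => h i j hij⟩
  rw [this]
  refine isClosed_iInter fun i => isClosed_iInter fun j => isClosed_iInter fun _ => ?_
  exact isClosed_eq (by fun_prop) continuous_const

instance instPolishSpaceDiagOne (n : ℕ) : PolishSpace (diagOne n) :=
  (isClosed_diagOne n).polishSpace

instance instLocallyCompactSpaceDiagOne (n : ℕ) : LocallyCompactSpace (diagOne n) :=
  (isClosed_diagOne n).isClosedEmbedding_subtypeVal.locallyCompactSpace

theorem diagOne_eq_diagonal {n : ℕ} (a : diagOne n) :
    ((a : SLn n) : Matrix (Fin n) (Fin n) ℝ) = diagonal fun i => (a : SLn n) i i :=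
  (Matrix.IsDiag.diagonal_diag a.2).symm

theorem prod_diagOne {n : ℕ} (a : diagOne n) : ∏ i, (a : SLn n) i i = 1 := by
  have h := (a : SLn n).det_coe
  rwa [diagOne_eq_diagonal a, det_diagonal] at h

theorem diagOne_apply_ne_zero {n : ℕ} (a : diagOne n) (i : Fin n) : (a : SLn n) i i ≠ 0 := by
  intro h
  exact zero_ne_one ((Finset.prod_eq_zero (f := fun i => (a : SLn n) i i)
    (Finset.mem_univ i) h).symm.trans (prod_diagOne a))

theorem continuous_diagChart (n : ℕ) : Continuous (diagChart n) := by
  unfold diagChart; fun_prop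

theorem diagChart_mul {n : ℕ} (a b : diagOne n) :
    diagChart n (a * b) = diagChart n a * diagChart n b := by
  ext i
  have h : (((a * b : diagOne n) : SLn n) : Matrix (Fin n) (Fin n) ℝ) =
      ((a : SLn n) : Matrix (Fin n) (Fin n) ℝ) * ((b : SLn n) : Matrix (Fin n) (Fin n) ℝ) := rfl
  rw [diagOne_eq_diagonal a, diagOne_eq_diagonal b, diagonal_mul_diagonal] at h
  exact (congrFun (congrFun h i.1) i.1).trans (diagonal_apply_eq _ _)

theorem diagChart_ne_zero {n : ℕ} (a : diagOne n) (i : DiagIndex n) : diagChart n a i ≠ 0 :=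
  diagOne_apply_ne_zero a i.1

/-- Determinant one fixes the last diagonal entry from the others. -/
theorem diagChart_succ_injective (m : ℕ) : Function.Injective (diagChart (m + 1)) := by
  intro a b h
  have h1 : ∀ i : DiagIndex (m + 1), (a : SLn (m + 1)) i.1 i.1 = (b : SLn (m + 1)) i.1 i.1 :=
    fun i => congrFun h i
  have h2 : (a : SLn (m + 1)) (Fin.last m) (Fin.last m) =
      (b : SLn (m + 1)) (Fin.last m) (Fin.last m) := by
    have ha := prod_diagOne a
    have hb := prod_diagOne b
    rw [prod_fin_eq_prod_diagIndex_mul_last] at ha hb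
    have hab : (∏ i : DiagIndex (m + 1), (a : SLn (m + 1)) i.1 i.1) =
        ∏ i : DiagIndex (m + 1), (b : SLn (m + 1)) i.1 i.1 := Finset.prod_congr rfl fun i _ => h1 i
    rw [hab] at ha
    exact mul_left_cancel₀ (left_ne_zero_of_mul_eq_one hb) (ha.trans hb.symm)
  refine Subtype.ext (Subtype.ext ?_)
  rw [diagOne_eq_diagonal a, diagOne_eq_diagonal b]
  congr 1
  ext j
  by_cases hj : (j : ℕ) + 1 < m + 1
  · exact h1 ⟨j, hj⟩
  · have : j = Fin.last m := Fin.ext (by simp only [Fin.val_last]; omega)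
    rw [this, h2]

theorem diagChart_injective (n : ℕ) : Function.Injective (diagChart n) := by
  cases n with
  | zero => exact fun a b _ => Subtype.ext (Subsingleton.elim _ _)
  | succ m => exact diagChart_succ_injective m

theorem measurableEmbedding_diagChart (n : ℕ) : MeasurableEmbedding (diagChart n) :=
  (continuous_diagChart n).measurableEmbedding (diagChart_injective n)

/-- The diagonal matrix of determinant one with given first entries. -/
def diagOf {m : ℕ} (a : DiagIndex (m + 1) → ℝ) : diagOne (m + 1) :=
  if h : ∀ i, a i ≠ 0 then
    ⟨⟨diagonal (diagVec a 1), by rw [det_diagonal, prod_diagVec h]⟩, isDiag_diagonal _⟩ else 1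

theorem coe_diagOf {m : ℕ} {a : DiagIndex (m + 1) → ℝ} (h : ∀ i, a i ≠ 0) :
    ((diagOf a : SLn (m + 1)) : Matrix (Fin (m + 1)) (Fin (m + 1)) ℝ) = diagonal (diagVec a 1) := by
  rw [diagOf, dif_pos h]

theorem diagChart_diagOf {m : ℕ} {a : DiagIndex (m + 1) → ℝ} (h : ∀ i, a i ≠ 0) :
    diagChart (m + 1) (diagOf a) = a := by
  ext i
  rw [diagChart, coe_diagOf h, diagonal_apply_eq, diagVec_diagIndex]

theorem range_diagChart_succ (m : ℕ) : Set.range (diagChart (m + 1)) = {a | ∀ i, a i ≠ 0} := by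
  ext a
  refine ⟨?_, fun h => ⟨diagOf a, diagChart_diagOf h⟩⟩
  rintro ⟨b, rfl⟩
  exact diagChart_ne_zero b

theorem diagOf_diagChart {m : ℕ} (a : diagOne (m + 1)) : diagOf (diagChart (m + 1) a) = a :=
  diagChart_injective _ (diagChart_diagOf (diagChart_ne_zero a))

theorem measurable_coe_diagOne {n : ℕ} {α : Type*} [MeasurableSpace α] {f : α → diagOne n} :
    Measurable f ↔ ∀ i j, Measurable fun x => ((f x : SLn n) : Matrix (Fin n) (Fin n) ℝ) i j := by
  rw [← measurable_SLn_iff]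
  exact ⟨fun h => measurable_subtype_coe.comp h, fun h => h.subtype_mk⟩

theorem measurableSet_forall_ne_zero {ι : Type*} [Fintype ι] :
    MeasurableSet {a : ι → ℝ | ∀ i, a i ≠ 0} := by
  rw [Set.ofPred_forall]
  exact MeasurableSet.iInter fun i => (measurable_pi_apply i) (measurableSet_singleton 0).compl

theorem measurable_diagOf {m : ℕ} : Measurable (diagOf (m := m)) := by
  rw [measurable_coe_diagOne]
  intro i j
  have : (fun a : DiagIndex (m + 1) → ℝ =>
      ((diagOf a : SLn (m + 1)) : Matrix (Fin (m + 1)) (Fin (m + 1)) ℝ) i j) =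
      fun a => if a ∈ {a : DiagIndex (m + 1) → ℝ | ∀ i, a i ≠ 0} then
        diagonal (diagVec a 1) i j else (1 : Matrix (Fin (m + 1)) (Fin (m + 1)) ℝ) i j := by
    ext a
    by_cases h : ∀ i, a i ≠ 0
    · rw [coe_diagOf h]
      exact (if_pos h).symm
    · rw [diagOf, dif_neg h]
      exact (if_neg h).symm
  rw [this]
  refine Measurable.ite measurableSet_forall_ne_zero ?_ measurable_const
  by_cases hij : i = j
  · subst hij
    simp only [diagonal_apply_eq]
    exact (measurable_diagVec i).comp (measurable_id.prodMk measurable_const)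
  · simp only [diagonal_apply_ne _ hij]
    exact measurable_const

theorem measurable_prod_inv_abs {ι : Type*} [Fintype ι] :
    Measurable fun x : ι → ℝ => ∏ i, ENNReal.ofReal (|x i|⁻¹) :=
  Finset.measurable_prod _ fun i _ => by fun_prop

/-- The measure `∏ dxᵢ / |xᵢ|`. -/
def prodInvMeasure (ι : Type*) [Fintype ι] : Measure (ι → ℝ) :=
  (volume : Measure (ι → ℝ)).withDensity fun x => ∏ i, ENNReal.ofReal (|x i|⁻¹)

/-- Scaling `xᵢ` by `vᵢ` multiplies `dxᵢ` by `|vᵢ|` and the density `1 / |xᵢ|` by `|vᵢ|⁻¹`. -/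
theorem prodInvMeasure_preimage_mul {ι : Type*} [Fintype ι] {v : ι → ℝ} (hv : ∀ i, v i ≠ 0)
    {s : Set (ι → ℝ)} (hs : MeasurableSet s) :
    prodInvMeasure ι ((fun x => v * x) ⁻¹' s) = prodInvMeasure ι s := by
  classical
  have hm : Measurable fun x : ι → ℝ => v * x := by fun_prop
  have hw := measurable_prod_inv_abs (ι := ι)
  rw [prodInvMeasure, withDensity_apply _ (hm hs), withDensity_apply _ hs,
    ← lintegral_indicator (hm hs), ← lintegral_indicator hs,
    ← lintegral_triangular (fun _ => 0) (c := fun i _ => v i) (g := fun _ _ => 0)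
      (fun _ => measurable_const) (fun _ => measurable_const) (fun i _ => hv i)
      (fun _ _ _ _ => rfl) (fun _ _ _ _ => rfl) (hw.indicator hs)]
  refine lintegral_congr fun x => ?_
  have e : (fun i => v i * x i + 0) = v * x := by ext i; simp
  rw [e]
  by_cases h : v * x ∈ s
  · rw [Set.indicator_of_mem h, Set.indicator_of_mem (show x ∈ (fun x => v * x) ⁻¹' s from h),
      ← Finset.prod_mul_distrib]
    refine Finset.prod_congr rfl fun i _ => ?_
    rw [← ENNReal.ofReal_mul (by positivity), Pi.mul_apply, abs_mul]
    congr 1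
    have := abs_ne_zero.2 (hv i)
    field_simp
  · rw [Set.indicator_of_notMem h, Set.indicator_of_notMem (show x ∉ (fun x => v * x) ⁻¹' s from h),
      zero_mul]

theorem diagMeasure_apply {n : ℕ} {s : Set (diagOne n)} :
    diagMeasure n s = prodInvMeasure (DiagIndex n) (diagChart n '' s) :=
  (measurableEmbedding_diagChart n).comap_apply _ _

/-- The chart turns group multiplication into coordinatewise multiplication by nonzero numbers. -/
instance instIsMulLeftInvariantDiagMeasure (n : ℕ) : (diagMeasure n).IsMulLeftInvariant := by
  refine ⟨fun b => Measure.ext fun s hs => ?_⟩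
  rw [Measure.map_apply (measurable_const_mul b) hs, diagMeasure_apply, diagMeasure_apply,
    ← prodInvMeasure_preimage_mul (diagChart_ne_zero b)
      ((measurableEmbedding_diagChart n).measurableSet_image.2 hs)]
  congr 1
  ext x
  constructor
  · rintro ⟨a, ha, rfl⟩
    exact ⟨b * a, ha, diagChart_mul b a⟩
  · rintro ⟨c, hc, hcx⟩
    refine ⟨b⁻¹ * c, by simpa using hc, ?_⟩
    have hcx' : diagChart n c = diagChart n b * x := hcx
    rw [diagChart_mul, hcx', ← mul_assoc, ← diagChart_mul, inv_mul_cancel]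
    ext i
    simp [diagChart]

/-- The chart maps a compact set to a compact set avoiding the coordinate hyperplanes, where the
density is continuous and hence bounded. -/
instance instIsFiniteMeasureOnCompactsDiagMeasure (n : ℕ) :
    IsFiniteMeasureOnCompacts (diagMeasure n) := by
  refine ⟨fun K hK => ?_⟩
  have hK' := hK.image (continuous_diagChart n)
  have hcont : ContinuousOn (fun x : DiagIndex n → ℝ => ∏ i, |x i|⁻¹) (diagChart n '' K) := by
    refine continuousOn_finsetProd _ fun i _ => ContinuousOn.inv₀ (by fun_prop) ?_
    rintro _ ⟨a, _, rfl⟩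
    exact abs_ne_zero.2 (diagChart_ne_zero a i)
  obtain ⟨C, hC⟩ := (hK'.image_of_continuousOn hcont).bddAbove
  rw [diagMeasure_apply, prodInvMeasure, withDensity_apply _ hK'.measurableSet]
  calc ∫⁻ x in diagChart n '' K, ∏ i, ENNReal.ofReal (|x i|⁻¹)
      ≤ ∫⁻ _ in diagChart n '' K, ENNReal.ofReal C := by
        refine setLIntegral_mono measurable_const fun x hx => ?_
        rw [← ENNReal.ofReal_prod_of_nonneg fun _ _ => by positivity]
        exact ENNReal.ofReal_le_ofReal (hC ⟨x, hx, rfl⟩)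
    _ < ⊤ := by
        rw [setLIntegral_const]
        exact ENNReal.mul_lt_top ENNReal.ofReal_lt_top hK'.measure_lt_top

theorem ae_forall_ne_zero {ι : Type*} [Fintype ι] : ∀ᵐ a : ι → ℝ, ∀ i, a i ≠ 0 :=
  ae_all_iff.2 ae_coord_ne_zero

theorem lintegral_diagMeasure {m : ℕ} {f : diagOne (m + 1) → ENNReal} (hf : Measurable f) :
    ∫⁻ a, f a ∂(diagMeasure (m + 1)) =
      ∫⁻ a : DiagIndex (m + 1) → ℝ, f (diagOf a) * ∏ i, ENNReal.ofReal (|a i|⁻¹) := by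
  have he := measurableEmbedding_diagChart (m + 1)
  have h1 : ∫⁻ a, f a ∂(diagMeasure (m + 1)) =
      ∫⁻ a, f (diagOf a) ∂(Measure.map (diagChart (m + 1)) (diagMeasure (m + 1))) := by
    rw [he.lintegral_map]
    simp only [diagOf_diagChart]
  have h2 : Measure.map (diagChart (m + 1)) (diagMeasure (m + 1)) =
      prodInvMeasure (DiagIndex (m + 1)) := by
    rw [diagMeasure, he.map_comap]
    refine Measure.restrict_eq_self_of_ae_mem ?_
    rw [range_diagChart_succ]
    exact (withDensity_absolutelyContinuous _ _).ae_le ae_forall_ne_zero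
  rw [h1, h2, prodInvMeasure]
  refine (lintegral_withDensity_eq_lintegral_mul _ measurable_prod_inv_abs
    (hf.comp measurable_diagOf)).trans (lintegral_congr fun a => ?_)
  simp [mul_comm]

theorem diagMeasure_ne_zero (n : ℕ) : diagMeasure n ≠ 0 := by
  intro h
  have h0 : prodInvMeasure (DiagIndex n) (Set.range (diagChart n)) = 0 := by
    rw [← Set.image_univ, ← diagMeasure_apply, h]; rfl
  rw [prodInvMeasure, withDensity_apply_eq_zero measurable_prod_inv_abs] at h0
  have h1 : ∀ᵐ x : DiagIndex n → ℝ, x ∈ {x | ∏ i, ENNReal.ofReal (|x i|⁻¹) ≠ 0} ∩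
      Set.range (diagChart n) := by
    filter_upwards [ae_forall_ne_zero] with x hx
    refine ⟨Finset.prod_ne_zero_iff.2 fun i _ => ?_, ?_⟩
    · simpa using hx i
    · cases n with
      | zero => exact ⟨1, funext fun i => i.1.elim0⟩
      | succ m => rw [range_diagChart_succ]; exact hx
  have h3 : ∀ᵐ x : DiagIndex n → ℝ, False := by
    filter_upwards [h1, measure_eq_zero_iff_ae_notMem.1 h0] with x hx hx' using hx' hx
  have h4 : (volume : Measure (DiagIndex n → ℝ)) = 0 := by simpa using h3
  exact NeZero.ne _ h4

theorem isHaarMeasure_diagMeasure (n : ℕ) : (diagMeasure n).IsHaarMeasure := by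
  have : NeZero (diagMeasure n) := ⟨diagMeasure_ne_zero n⟩
  exact { }

/-! ### Haar measure on `SL_n(ℝ)` -/

/-- The matrix with given entries. -/
def ofEntries {n : ℕ} (x : Fin n × Fin n → ℝ) : Matrix (Fin n) (Fin n) ℝ :=
  Matrix.of fun i j => x (i, j)

theorem continuous_ofEntries {n : ℕ} : Continuous (ofEntries (n := n)) :=
  (entriesHomeomorph n).symm.continuous

theorem ofEntries_entries {n : ℕ} (M : Matrix (Fin n) (Fin n) ℝ) : ofEntries (entries M) = M := rfl

theorem continuous_expLower {n : ℕ} : Continuous (expLower (n := n)) :=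
  (continuous_matrix_exp.comp continuous_lowerMatrix).subtype_mk _

theorem continuous_expUpper {n : ℕ} : Continuous (expUpper (n := n)) :=
  (continuous_matrix_exp.comp continuous_upperMatrix).subtype_mk _

theorem continuous_ludMap {n : ℕ} :
    Continuous fun p : (StrictLower n → ℝ) × (StrictUpper n → ℝ) × diagOne n =>
      ludMap p.1 p.2.1 p.2.2 :=
  ((continuous_expLower.comp continuous_fst).mul
    (continuous_expUpper.comp (continuous_fst.comp continuous_snd))).mul
    (continuous_subtype_val.comp (continuous_snd.comp continuous_snd))

/-- The measure `dX dY da` carried to `SL_n(ℝ)` by `(X, Y, a) ↦ exp(X) exp(Y) a`. -/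
def ludMeasure (n : ℕ) : Measure (SLn n) :=
  Measure.map (fun p : (StrictLower n → ℝ) × (StrictUpper n → ℝ) × diagOne n =>
      ludMap p.1 p.2.1 p.2.2)
    ((volume : Measure (StrictLower n → ℝ)).prod
      ((volume : Measure (StrictUpper n → ℝ)).prod (diagMeasure n)))

theorem prod_update_one_last {m : ℕ} (δ : ℝ) :
    ∏ j, Function.update (1 : Fin (m + 1) → ℝ) (Fin.last m) δ j = δ := by
  rw [Finset.prod_update_of_mem (Finset.mem_univ _)]
  simp

/-- Division of the last column of an invertible matrix by its determinant. -/
def divLastColumn {m : ℕ} (M : Matrix (Fin (m + 1)) (Fin (m + 1)) ℝ) : SLn (m + 1) :=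
  if h : M.det ≠ 0 then
    ⟨M * diagonal (Function.update 1 (Fin.last m) M.det⁻¹), by
      rw [det_mul, det_diagonal, prod_update_one_last, mul_inv_cancel₀ h]⟩ else 1

theorem coe_divLastColumn {m : ℕ} {M : Matrix (Fin (m + 1)) (Fin (m + 1)) ℝ} (h : M.det ≠ 0) :
    (divLastColumn M : Matrix (Fin (m + 1)) (Fin (m + 1)) ℝ) =
      M * diagonal (Function.update 1 (Fin.last m) M.det⁻¹) :=
  congrArg Subtype.val (dif_pos h)

/-- The division is right multiplication by a matrix depending on `det M` only, and `det (g M) = det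
M`. This equivariance is the source of left invariance. -/
theorem divLastColumn_mul {m : ℕ} (g : SLn (m + 1)) {M : Matrix (Fin (m + 1)) (Fin (m + 1)) ℝ}
    (h : M.det ≠ 0) :
    divLastColumn ((g : Matrix (Fin (m + 1)) (Fin (m + 1)) ℝ) * M) = g * divLastColumn M := by
  have hd : ((g : Matrix (Fin (m + 1)) (Fin (m + 1)) ℝ) * M).det = M.det := by
    rw [det_mul, g.det_coe, one_mul]
  refine Subtype.ext ?_
  refine (coe_divLastColumn (by rwa [hd])).trans ?_
  rw [hd, mul_assoc, ← coe_divLastColumn h]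
  rfl

theorem measurable_divLastColumn_ofEntries {m : ℕ} :
    Measurable fun x : Fin (m + 1) × Fin (m + 1) → ℝ => divLastColumn (ofEntries x) := by
  rw [measurable_SLn_iff]
  intro i j
  have hdet : Measurable fun x : Fin (m + 1) × Fin (m + 1) → ℝ => (ofEntries x).det :=
    continuous_ofEntries.matrix_det.measurable
  have : (fun x : Fin (m + 1) × Fin (m + 1) → ℝ =>
      (divLastColumn (ofEntries x) : Matrix (Fin (m + 1)) (Fin (m + 1)) ℝ) i j) =
      fun x => if (ofEntries x).det = 0 then (1 : Matrix (Fin (m + 1)) (Fin (m + 1)) ℝ) i j else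
        x (i, j) * Function.update (1 : Fin (m + 1) → ℝ) (Fin.last m) (ofEntries x).det⁻¹ j := by
    ext x
    by_cases h : (ofEntries x).det = 0
    · simp [divLastColumn, h]
    · rw [coe_divLastColumn h, if_neg h, mul_diagonal]; rfl
  rw [this]
  refine Measurable.ite (hdet (measurableSet_singleton 0)) measurable_const
    ((measurable_pi_apply _).mul ?_)
  by_cases hj : j = Fin.last m
  · subst hj
    simp only [Function.update_self]
    exact hdet.inv
  · simp [Function.update_of_ne hj]

/-- The weight `1_{[1, 2]}(δ) / |δ|^m`. -/
def detWeight (m : ℕ) (δ : ℝ) : ENNReal :=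
  (Set.Icc (1 : ℝ) 2).indicator (fun δ => (ENNReal.ofReal |δ| ^ m)⁻¹) δ

theorem measurable_detWeight (m : ℕ) : Measurable (detWeight m) :=
  Measurable.indicator (by fun_prop) measurableSet_Icc

/-- The weight is chosen to cancel the Jacobian factor `|δ|^m` of `lintegral_ludMatrix`. -/
theorem detWeight_mul_pow (m : ℕ) (δ : ℝ) :
    detWeight m δ * ENNReal.ofReal |δ| ^ m = (Set.Icc (1 : ℝ) 2).indicator 1 δ := by
  unfold detWeight
  by_cases h : δ ∈ Set.Icc (1 : ℝ) 2
  · have hpos : 0 < |δ| := abs_pos.2 (by linarith [h.1])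
    rw [Set.indicator_of_mem h, Set.indicator_of_mem h, Pi.one_apply,
      ENNReal.inv_mul_cancel (pow_ne_zero _ (by simpa using hpos)) (by finiteness)]
  · rw [Set.indicator_of_notMem h, Set.indicator_of_notMem h, zero_mul]

theorem detWeight_le_indicator (m : ℕ) (δ : ℝ) :
    detWeight m δ ≤ (Set.Icc (1 : ℝ) 2).indicator 1 δ := by
  unfold detWeight
  refine Set.indicator_rel_indicator le_rfl fun h => ?_
  rw [Pi.one_apply, ENNReal.inv_le_one]
  exact one_le_pow₀ (ENNReal.one_le_ofReal.2 (h.1.trans (le_abs_self δ)))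

/-- The positions of a matrix: below, above, on the diagonal except the last one, the last one. -/
def positionEquiv (m : ℕ) :
    StrictLower (m + 1) ⊕ (StrictUpper (m + 1) ⊕ (DiagIndex (m + 1) ⊕ Unit)) ≃
      Fin (m + 1) × Fin (m + 1) :=
  Equiv.ofBijective
    (Sum.elim (fun p => p.1) (Sum.elim (fun p => p.1)
      (Sum.elim (fun i => (i.1, i.1)) fun _ => (Fin.last m, Fin.last m)))) (by
    constructor
    · refine Subtype.val_injective.sumElim (Subtype.val_injective.sumElim
        (Function.Injective.sumElim (fun i j h => Subtype.ext (congrArg Prod.fst h))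
          (fun _ _ _ => rfl) fun i _ h => ?_) ?_) ?_
      · have h1 := congrArg (fun p : Fin (m + 1) × Fin (m + 1) => (p.1 : ℕ)) h
        have h2 := i.2
        simp only [Fin.val_last] at h1
        omega
      · rintro ⟨p, h⟩ (i | _) rfl
        exacts [lt_irrefl _ h, lt_irrefl _ h]
      · rintro ⟨p, h⟩ (⟨q, h'⟩ | i | _) rfl
        exacts [lt_asymm h h', lt_irrefl _ h, lt_irrefl _ h]
    · rintro ⟨i, j⟩
      rcases lt_trichotomy i j with h | rfl | h
      · exact ⟨.inr (.inl ⟨(i, j), h⟩), rfl⟩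
      · by_cases hi : (i : ℕ) + 1 < m + 1
        · exact ⟨.inr (.inr (.inl ⟨i, hi⟩)), rfl⟩
        · refine ⟨.inr (.inr (.inr ())), ?_⟩
          have : i = Fin.last m := Fin.ext (by simp only [Fin.val_last]; omega)
          rw [this]; rfl
      · exact ⟨.inl ⟨(i, j), h⟩, rfl⟩)

/-- The coordinates `X`, `Y`, `a` and the determinant, out of the entries. -/
def splitCoord {m : ℕ} (z : Fin (m + 1) × Fin (m + 1) → ℝ) :
    (StrictLower (m + 1) → ℝ) × (StrictUpper (m + 1) → ℝ) × (DiagIndex (m + 1) → ℝ) × (Unit → ℝ) :=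
  (lowerPart z, upperPart z, diagPart z, fun _ => z (Fin.last m, Fin.last m))

theorem measurePreserving_splitCoord (m : ℕ) : MeasurePreserving (splitCoord (m := m)) := by
  have h1 := (volume_measurePreserving_piCongrLeft (fun _ => ℝ) (positionEquiv m)).symm
  have h2 := volume_measurePreserving_sumPiEquivProdPi
    (fun _ : StrictLower (m + 1) ⊕ (StrictUpper (m + 1) ⊕ (DiagIndex (m + 1) ⊕ Unit)) => ℝ)
  have h3 := volume_measurePreserving_sumPiEquivProdPi
    (fun _ : StrictUpper (m + 1) ⊕ (DiagIndex (m + 1) ⊕ Unit) => ℝ)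
  have h4 := volume_measurePreserving_sumPiEquivProdPi (fun _ : DiagIndex (m + 1) ⊕ Unit => ℝ)
  have h5 := (MeasurePreserving.id (volume : Measure (StrictUpper (m + 1) → ℝ))).prod h4
  have h6 := (MeasurePreserving.id (volume : Measure (StrictLower (m + 1) → ℝ))).prod (h5.comp h3)
  exact (h6.comp h2).comp h1

theorem diagonal_diagVec {m : ℕ} (a : DiagIndex (m + 1) → ℝ) (δ : ℝ) :
    diagonal (diagVec a δ) =
      diagonal (diagVec a 1) * diagonal (Function.update (1 : Fin (m + 1) → ℝ) (Fin.last m) δ) := by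
  rw [diagonal_mul_diagonal]
  congr 1
  ext j
  by_cases hj : (j : ℕ) + 1 < m + 1
  · have : j ≠ Fin.last m := by rintro rfl; simp at hj
    simp [diagVec, hj, this]
  · have : j = Fin.last m := Fin.ext (by simp only [Fin.val_last]; omega)
    subst this
    simp [diagVec]

theorem det_ludMatrix {m : ℕ} {z : Fin (m + 1) × Fin (m + 1) → ℝ} (hz : ∀ p, z p ≠ 0) :
    (ludMatrix z).det = z (Fin.last m, Fin.last m) := by
  rw [ludMatrix, det_mul, det_mul, det_exp_lowerMatrix, det_exp_upperMatrix, det_diagonal, fullDiag,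
    prod_diagVec (a := diagPart z) fun i => hz _, one_mul, one_mul]

/-- The determinant `δ` sits entirely in the last entry of `d`, so dividing the last column strips
it off and leaves `a`. -/
theorem divLastColumn_ludMatrix {m : ℕ} {z : Fin (m + 1) × Fin (m + 1) → ℝ} (hz : ∀ p, z p ≠ 0) :
    divLastColumn (ludMatrix z) = ludMap (lowerPart z) (upperPart z) (diagOf (diagPart z)) := by
  refine Subtype.ext ?_
  rw [coe_divLastColumn (by rw [det_ludMatrix hz]; exact hz _), det_ludMatrix hz]
  change _ = NormedSpace.exp (lowerMatrix (lowerPart z)) *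
    NormedSpace.exp (upperMatrix (upperPart z)) *
    ((diagOf (diagPart z) : SLn (m + 1)) : Matrix (Fin (m + 1)) (Fin (m + 1)) ℝ)
  rw [coe_diagOf (a := diagPart z) fun i => hz _, ludMatrix, mul_assoc _ (diagonal _) (diagonal _)]
  congr 1
  rw [fullDiag, diagonal_diagVec, mul_assoc, diagonal_mul_diagonal (Function.update _ _ _)]
  convert mul_one _ using 2
  rw [← diagonal_one]
  congr 1
  ext j
  by_cases hj : j = Fin.last m
  · subst hj
    simp [mul_inv_cancel₀ (hz (Fin.last m, Fin.last m))]
  · simp [hj]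

theorem lintegral_volume_prod_prod_prod {α β γ δ : Type*} [MeasureSpace α] [MeasureSpace β]
    [MeasureSpace γ] [MeasureSpace δ] [SFinite (volume : Measure α)] [SFinite (volume : Measure β)]
    [SFinite (volume : Measure γ)] [SFinite (volume : Measure δ)]
    {G : α × β × γ × δ → ENNReal} (hG : Measurable G) :
    ∫⁻ q, G q = ∫⁻ a, ∫⁻ b, ∫⁻ c, ∫⁻ d, G (a, b, c, d) := by
  refine (lintegral_prod _ hG.aemeasurable).trans (lintegral_congr fun a => ?_)
  have ha := hG.comp (measurable_prodMk_left (x := a))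
  refine (lintegral_prod _ ha.aemeasurable).trans (lintegral_congr fun b => ?_)
  exact lintegral_prod _ (ha.comp (measurable_prodMk_left (x := b))).aemeasurable

/-- `ludMeasure` in terms of Lebesgue measure on the space of all matrices. -/
theorem lintegral_ludMeasure {m : ℕ} {φ : SLn (m + 1) → ENNReal} (hφ : Measurable φ) :
    ∫⁻ g, φ g ∂(ludMeasure (m + 1)) =
      ∫⁻ x, φ (divLastColumn (ofEntries x)) * detWeight m (ofEntries x).det := by
  have hF : Measurable fun x : Fin (m + 1) × Fin (m + 1) → ℝ =>
      φ (divLastColumn (ofEntries x)) * detWeight m (ofEntries x).det :=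
    (hφ.comp measurable_divLastColumn_ofEntries).mul
      ((measurable_detWeight m).comp continuous_ofEntries.matrix_det.measurable)
  let G : (StrictLower (m + 1) → ℝ) × (StrictUpper (m + 1) → ℝ) × (DiagIndex (m + 1) → ℝ) ×
      (Unit → ℝ) → ENNReal := fun q =>
    φ (ludMap q.1 q.2.1 (diagOf q.2.2.1)) * (∏ i, ENNReal.ofReal (|q.2.2.1 i|⁻¹)) *
      (Set.Icc (1 : ℝ) 2).indicator 1 (q.2.2.2 ())
  have hG1 : Measurable fun q : (StrictLower (m + 1) → ℝ) × (StrictUpper (m + 1) → ℝ) ×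
      (DiagIndex (m + 1) → ℝ) =>
      φ (ludMap q.1 q.2.1 (diagOf q.2.2)) * (∏ i, ENNReal.ofReal (|q.2.2 i|⁻¹)) := by
    refine (hφ.comp (continuous_ludMap.measurable.comp (measurable_fst.prodMk
      ((measurable_fst.comp measurable_snd).prodMk
        (measurable_diagOf.comp (measurable_snd.comp measurable_snd)))))).mul
      (measurable_prod_inv_abs.comp (measurable_snd.comp measurable_snd))
  have hI : Measurable ((Set.Icc (1 : ℝ) 2).indicator (1 : ℝ → ENNReal)) :=
    measurable_one.indicator measurableSet_Icc
  have hG : Measurable G :=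
    (hG1.comp (by fun_prop : Measurable fun q : (StrictLower (m + 1) → ℝ) ×
      (StrictUpper (m + 1) → ℝ) × (DiagIndex (m + 1) → ℝ) × (Unit → ℝ) =>
      (q.1, q.2.1, q.2.2.1))).mul (hI.comp (by fun_prop))
  have hφL : Measurable fun p : (StrictLower (m + 1) → ℝ) × (StrictUpper (m + 1) → ℝ) ×
      diagOne (m + 1) => φ (ludMap p.1 p.2.1 p.2.2) := hφ.comp continuous_ludMap.measurable
  -- The interval `[1, 2]` has length one, so the determinant can be adjoined as an extra variable
  -- without changing the integral.
  have hunit : ∫⁻ u : Unit → ℝ, (Set.Icc (1 : ℝ) 2).indicator (1 : ℝ → ENNReal) (u ()) = 1 := by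
    have h := (volume_preserving_funUnique Unit ℝ).lintegral_comp hI
    refine h.trans ?_
    rw [lintegral_indicator_one measurableSet_Icc, Real.volume_Icc]
    norm_num
  calc ∫⁻ g, φ g ∂(ludMeasure (m + 1))
      = ∫⁻ X, ∫⁻ Y, ∫⁻ a, φ (ludMap X Y a) ∂(diagMeasure (m + 1)) := by
        rw [ludMeasure, lintegral_map hφ continuous_ludMap.measurable,
          lintegral_prod _ hφL.aemeasurable]
        refine lintegral_congr fun X => ?_
        exact lintegral_prod _ (hφL.comp measurable_prodMk_left).aemeasurable
    _ = ∫⁻ X, ∫⁻ Y, ∫⁻ a, ∫⁻ u, G (X, Y, a, u) := by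
        refine lintegral_congr fun X => lintegral_congr fun Y => ?_
        have hXY : Measurable fun a : diagOne (m + 1) => φ (ludMap X Y a) :=
          hφ.comp ((measurable_const_mul (expLower X * expUpper Y)).comp measurable_subtype_coe)
        rw [lintegral_diagMeasure hXY]
        refine lintegral_congr fun a => ?_
        simp only [G]
        have hIu : Measurable fun u : Unit → ℝ =>
            (Set.Icc (1 : ℝ) 2).indicator (1 : ℝ → ENNReal) (u ()) :=
          hI.comp (measurable_pi_apply ())
        rw [lintegral_const_mul _ hIu, hunit, mul_one]
    _ = ∫⁻ q, G q := by
        exact (lintegral_volume_prod_prod_prod hG).symm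
    _ = ∫⁻ z, G (splitCoord z) := ((measurePreserving_splitCoord m).lintegral_comp hG).symm
    _ = _ := by
        rw [← lintegral_ludMatrix hF]
        refine lintegral_congr_ae ?_
        filter_upwards [ae_all_iff.2 (ae_coord_ne_zero (ι := Fin (m + 1) × Fin (m + 1)))] with z hz
        rw [ofEntries_entries, det_ludMatrix hz, divLastColumn_ludMatrix hz]
        simp only [G, splitCoord]
        rw [← detWeight_mul_pow m]
        ring

/-- Left multiplication acts on each column by `g`; as a linear map on entries it is `g ⊗ 1`, of
determinant `(det g)^n = 1`. -/
theorem lintegral_entries_mul {n : ℕ} (g : SLn n) {F : (Fin n × Fin n → ℝ) → ENNReal}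
    (hF : Measurable F) :
    ∫⁻ x, F (entries ((g : Matrix (Fin n) (Fin n) ℝ) * ofEntries x)) = ∫⁻ x, F x := by
  let A : Matrix (Fin n × Fin n) (Fin n × Fin n) ℝ :=
    kroneckerMap (· * ·) (g : Matrix (Fin n) (Fin n) ℝ) (1 : Matrix (Fin n) (Fin n) ℝ)
  have hA : A.det = 1 := by
    rw [show A.det = _ from det_kronecker _ _, g.det_coe]
    simp
  have hmap := Real.map_matrix_volume_pi_eq_smul_volume_pi (M := A) (by rw [hA]; exact one_ne_zero)
  rw [hA, inv_one, abs_one, ENNReal.ofReal_one, one_smul] at hmap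
  conv_rhs => rw [← hmap]
  rw [lintegral_map hF (LinearMap.continuous_on_pi _).measurable]
  refine lintegral_congr fun x => ?_
  congr 1
  ext ⟨i, j⟩
  simp only [entries, ofEntries, Matrix.mul_apply, of_apply, toLin'_apply, mulVec, dotProduct, A,
    kroneckerMap_apply, Fintype.sum_prod_type]
  refine Finset.sum_congr rfl fun k _ => ?_
  simp [Matrix.one_apply]

theorem lintegral_ludMeasure_mul_left {m : ℕ} (g : SLn (m + 1)) {φ : SLn (m + 1) → ENNReal}
    (hφ : Measurable φ) :
    ∫⁻ h, φ (g * h) ∂(ludMeasure (m + 1)) = ∫⁻ h, φ h ∂(ludMeasure (m + 1)) := by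
  have hF : Measurable fun x : Fin (m + 1) × Fin (m + 1) → ℝ =>
      φ (divLastColumn (ofEntries x)) * detWeight m (ofEntries x).det :=
    (hφ.comp measurable_divLastColumn_ofEntries).mul
      ((measurable_detWeight m).comp continuous_ofEntries.matrix_det.measurable)
  rw [lintegral_ludMeasure hφ, ← lintegral_entries_mul g hF]
  refine (lintegral_ludMeasure (hφ.comp (measurable_const_mul g))).trans
    (lintegral_congr fun x => ?_)
  have hd : ((g : Matrix (Fin (m + 1)) (Fin (m + 1)) ℝ) * ofEntries x).det = (ofEntries x).det := by
    rw [det_mul, g.det_coe, one_mul]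
  rw [ofEntries_entries, hd]
  -- On singular matrices `divLastColumn` has the default value `1`, which is not equivariant, but
  -- the weight vanishes there.
  by_cases h : (ofEntries x).det = 0
  · have h0 : detWeight m (ofEntries x).det = 0 := by
      rw [h, detWeight, Set.indicator_of_notMem]
      simp
    rw [h0, mul_zero, mul_zero]
  · rw [divLastColumn_mul g h, Function.comp_apply]

instance instIsMulLeftInvariantLudMeasure (n : ℕ) : (ludMeasure n).IsMulLeftInvariant := by
  refine ⟨fun g => ?_⟩
  cases n with
  | zero =>
    have : (fun h : SLn 0 => g * h) = id := funext fun _ => Subsingleton.elim _ _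
    rw [this, Measure.map_id]
  | succ m =>
    refine Measure.ext fun s hs => ?_
    have h := lintegral_ludMeasure_mul_left g (measurable_one.indicator hs)
    rw [← lintegral_map (measurable_one.indicator hs) (measurable_const_mul g),
      lintegral_indicator_one hs, lintegral_indicator_one hs] at h
    exact h

/-- For `n ≥ 1`, a matrix with determinant `δ ∈ [1, 2]` and normalization in `K` is an element of
`K` with its last column multiplied by `δ`. Such matrices form a compact image of `K × [1, 2]`, and
the weight is at most one. -/
instance instIsFiniteMeasureOnCompactsLudMeasure (n : ℕ) :
    IsFiniteMeasureOnCompacts (ludMeasure n) := by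
  refine ⟨fun K hK => ?_⟩
  cases n with
  | zero =>
    have : IsFiniteMeasure (diagMeasure 0) := inferInstance
    have : IsFiniteMeasure (ludMeasure 0) := by
      unfold ludMeasure; infer_instance
    exact measure_lt_top _ _
  | succ m =>
    let f : SLn (m + 1) × ℝ → (Fin (m + 1) × Fin (m + 1) → ℝ) := fun q =>
      entries ((q.1 : Matrix (Fin (m + 1)) (Fin (m + 1)) ℝ) *
        diagonal (Function.update (1 : Fin (m + 1) → ℝ) (Fin.last m) q.2))
    have hf : Continuous f := by
      refine continuous_entries.comp ((continuous_subtype_val.comp continuous_fst).matrix_mul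
        (Continuous.matrix_diagonal ?_))
      exact continuous_const.update _ continuous_snd
    have hC := (hK.prod (isCompact_Icc (a := (1 : ℝ)) (b := 2))).image hf
    have hKm := hK.measurableSet
    rw [← lintegral_indicator_one hKm, lintegral_ludMeasure (measurable_one.indicator hKm)]
    refine lt_of_le_of_lt (b := ∫⁻ x, (f '' (K ×ˢ Set.Icc 1 2)).indicator 1 x)
      (lintegral_mono fun x => ?_) ?_
    · by_cases hd : (ofEntries x).det ∈ Set.Icc (1 : ℝ) 2
      · have hd0 : (ofEntries x).det ≠ 0 := by linarith [hd.1]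
        by_cases hx : divLastColumn (ofEntries x) ∈ K
        · have hmem : x ∈ f '' (K ×ˢ Set.Icc 1 2) := by
            refine ⟨(divLastColumn (ofEntries x), (ofEntries x).det), ⟨hx, hd⟩, ?_⟩
            simp only [f]
            rw [coe_divLastColumn hd0, mul_assoc, diagonal_mul_diagonal]
            have : (fun i => Function.update (1 : Fin (m + 1) → ℝ) (Fin.last m)
                (ofEntries x).det⁻¹ i * Function.update (1 : Fin (m + 1) → ℝ) (Fin.last m)
                (ofEntries x).det i) = 1 := by
              ext j
              by_cases hj : j = Fin.last m
              · subst hj; simp [hd0]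
              · simp [hj]
            rw [this, show diagonal (1 : Fin (m + 1) → ℝ) = 1 from diagonal_one, mul_one]
            rfl
          rw [Set.indicator_of_mem hx, Set.indicator_of_mem hmem, Pi.one_apply, one_mul]
          refine (detWeight_le_indicator m _).trans ?_
          rw [Set.indicator_of_mem hd, Pi.one_apply, Pi.one_apply]
        · rw [Set.indicator_of_notMem hx, zero_mul]
          exact zero_le
      · rw [detWeight, Set.indicator_of_notMem hd, mul_zero]
        exact zero_le
    · rw [lintegral_indicator_one hC.measurableSet]
      exact hC.measure_lt_top

theorem ludMeasure_ne_zero (n : ℕ) : ludMeasure n ≠ 0 := by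
  have : NeZero (diagMeasure n) := ⟨diagMeasure_ne_zero n⟩
  rw [ludMeasure, Measure.map_ne_zero_iff continuous_ludMap.aemeasurable]
  rw [← Measure.measure_univ_ne_zero, ← Set.univ_prod_univ, Measure.prod_prod,
    ← Set.univ_prod_univ, Measure.prod_prod]
  exact mul_ne_zero (NeZero.ne _) (mul_ne_zero (NeZero.ne _) (NeZero.ne _))

theorem isHaarMeasure_ludMeasure (n : ℕ) : (ludMeasure n).IsHaarMeasure := by
  have : NeZero (ludMeasure n) := ⟨ludMeasure_ne_zero n⟩
  exact { }

theorem integrable_and_integral_ludMeasure {n : ℕ} {φ : SLn n → ℂ} (hφ : Continuous φ)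
    (hφc : HasCompactSupport φ) :
    Integrable (fun p : (StrictLower n → ℝ) × (StrictUpper n → ℝ) × diagOne n =>
        φ (ludMap p.1 p.2.1 p.2.2))
      ((volume : Measure (StrictLower n → ℝ)).prod
        ((volume : Measure (StrictUpper n → ℝ)).prod (diagMeasure n))) ∧
    ∫ g, φ g ∂(ludMeasure n) = ∫ x : StrictLower n → ℝ, ∫ y : StrictUpper n → ℝ,
      ∫ a : diagOne n, φ (ludMap x y a) ∂(diagMeasure n) := by
  have hint : Integrable φ (ludMeasure n) := hφ.integrable_of_hasCompactSupport hφc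
  have h : Integrable (fun p : (StrictLower n → ℝ) × (StrictUpper n → ℝ) × diagOne n =>
        φ (ludMap p.1 p.2.1 p.2.2))
      ((volume : Measure (StrictLower n → ℝ)).prod
        ((volume : Measure (StrictUpper n → ℝ)).prod (diagMeasure n))) :=
    (integrable_map_measure hφ.aestronglyMeasurable continuous_ludMap.aemeasurable).1 hint
  refine ⟨h, ?_⟩
  rw [ludMeasure, integral_map continuous_ludMap.aemeasurable hφ.aestronglyMeasurable,
    integral_prod _ h]
  refine integral_congr_ae ?_
  filter_upwards [h.prod_right_ae] with x hx
  exact integral_prod _ hx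

/-! ### The determinant of an exponential -/

/-- The derivative of the determinant at the identity is the trace. -/
theorem hasDerivAt_det_of_eq_one {m : Type*} [Fintype m] [DecidableEq m] {M : ℝ → Matrix m m ℝ}
    {M' : Matrix m m ℝ} {t : ℝ} (hM : ∀ i j, HasDerivAt (fun u => M u i j) (M' i j) t)
    (h1 : M t = 1) : HasDerivAt (fun u => (M u).det) M'.trace t := by
  have h : HasDerivAt (fun u => ∑ σ : Equiv.Perm m, (Equiv.Perm.sign σ : ℝ) * ∏ i, M u (σ i) i)
      (∑ σ : Equiv.Perm m, (Equiv.Perm.sign σ : ℝ) *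
        ∑ i, (∏ j ∈ Finset.univ.erase i, M t (σ j) j) • M' (σ i) i) t :=
    HasDerivAt.fun_sum fun σ _ =>
      (HasDerivAt.fun_finsetProd fun i _ => hM (σ i) i).const_mul _
  have hd : (fun u => (M u).det) =
      fun u => ∑ σ : Equiv.Perm m, (Equiv.Perm.sign σ : ℝ) * ∏ i, M u (σ i) i := by
    ext u; rw [det_apply']
  rw [hd]
  convert h using 1
  rw [Finset.sum_eq_single 1]
  · simp [h1, trace]
  · intro σ _ hσ
    rw [Finset.sum_eq_zero, mul_zero]
    intro i _
    obtain ⟨j, hj⟩ : ∃ j, σ j ≠ j := by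
      by_contra hc
      push Not at hc
      exact hσ (Equiv.ext hc)
    -- A nontrivial permutation moves at least two points, so after the factor `i` is removed an
    -- off-diagonal entry of the identity remains.
    have hk : ∃ k, k ≠ i ∧ σ k ≠ k := by
      by_cases hji : j = i
      · subst hji
        exact ⟨σ j, hj, fun h => hj (σ.injective h)⟩
      · exact ⟨j, hji, hj⟩
    obtain ⟨k, hki, hk⟩ := hk
    rw [Finset.prod_eq_zero (i := k) (by simp [hki]) (by rw [h1, one_apply_ne hk]), zero_smul]
  · simp

/-- Jacobi's formula for exponentials: `det (exp A) = exp (tr A)`. -/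
theorem det_matrix_exp {m : Type*} [Fintype m] [DecidableEq m] (A : Matrix m m ℝ) :
    (NormedSpace.exp A).det = Real.exp A.trace := by
  have hentry : ∀ i j, HasDerivAt (fun u : ℝ => NormedSpace.exp (u • A) i j) (A i j) 0 := by
    intro i j
    let _ : NormedRing (Matrix m m ℝ) := Matrix.linftyOpNormedRing
    let _ : NormedAlgebra ℝ (Matrix m m ℝ) := Matrix.linftyOpNormedAlgebra
    have h := hasDerivAt_exp_smul_const (𝕂 := ℝ) A 0
    rw [zero_smul, NormedSpace.exp_zero, one_mul] at h
    exact ((LinearMap.toContinuousLinearMap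
      (Matrix.entryLinearMap ℝ ℝ i j)).hasFDerivAt.comp_hasDerivAt (0 : ℝ) h)
  let f : ℝ → ℝ := fun u => (NormedSpace.exp (u • A)).det
  have hf0 : f 0 = 1 := by simp [f]
  have hadd : ∀ s u, f (s + u) = f s * f u := by
    intro s u
    simp only [f]
    rw [add_smul, Matrix.exp_add_of_commute _ _ ((Commute.refl A).smul_left s |>.smul_right u),
      det_mul]
  have hd0 : HasDerivAt f A.trace 0 := hasDerivAt_det_of_eq_one hentry (by simp)
  -- The identity `f u = f t * f (u - t)` carries the derivative at `0` to every `t`; the resulting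
  -- equation `f' = f · tr A` makes `f u * exp (-u tr A)` constant.
  have hd : ∀ t, HasDerivAt f (f t * A.trace) t := by
    intro t
    have h1 : HasDerivAt (fun u => f (u - t)) A.trace t :=
      HasDerivAt.comp_sub_const t t (by rwa [sub_self])
    have h2 := h1.const_mul (f t)
    refine h2.congr_of_eventuallyEq (Eventually.of_forall fun u => ?_)
    dsimp only
    rw [← hadd, add_sub_cancel]
  have hg : ∀ t, HasDerivAt (fun u => f u * Real.exp (-(u * A.trace))) 0 t := by
    intro t
    have he : HasDerivAt (fun u : ℝ => Real.exp (-(u * A.trace)))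
        (Real.exp (-(t * A.trace)) * (-(1 * A.trace))) t :=
      (((hasDerivAt_id t).mul_const A.trace).neg).exp
    have h0 := (hd t).mul he
    rwa [show f t * A.trace * Real.exp (-(t * A.trace)) +
      f t * (Real.exp (-(t * A.trace)) * (-(1 * A.trace))) = 0 by ring] at h0
  have hconst := is_const_of_deriv_eq_zero (fun t => (hg t).differentiableAt)
    (fun t => (hg t).deriv) 1 0
  simp only [hf0, one_mul, zero_mul, neg_zero, Real.exp_zero] at hconst
  have hf1 : f 1 = (NormedSpace.exp A).det := by simp [f]
  rw [← hf1]
  calc f 1 = f 1 * Real.exp (-A.trace) * Real.exp A.trace := by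
        rw [mul_assoc, ← Real.exp_add, neg_add_cancel, Real.exp_zero, mul_one]
    _ = Real.exp A.trace := by rw [hconst, one_mul]

/-! ### Local coordinates near the identity -/

/-- The product of exponentials of two complementary components is a local homeomorphism at `0`. -/
theorem exp_mul_exp_local {𝔸 : Type*} [NormedRing 𝔸] [NormedAlgebra ℝ 𝔸] [CompleteSpace 𝔸]
    (P : 𝔸 →L[ℝ] 𝔸) :
    (∃ U ∈ 𝓝 (0 : 𝔸),
      Set.InjOn (fun Z => NormedSpace.exp (P Z) * NormedSpace.exp (Z - P Z)) U) ∧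
    map (fun Z => NormedSpace.exp (P Z) * NormedSpace.exp (Z - P Z)) (𝓝 (0 : 𝔸)) = 𝓝 1 := by
  have hexp : ∀ Q : 𝔸 →L[ℝ] 𝔸, HasStrictFDerivAt (fun Z => NormedSpace.exp (Q Z)) Q 0 := by
    intro Q
    have h : HasStrictFDerivAt (NormedSpace.exp : 𝔸 → 𝔸) (1 : 𝔸 →L[ℝ] 𝔸) (Q 0) := by
      rw [map_zero]; exact hasStrictFDerivAt_exp_zero
    exact h.comp 0 Q.hasStrictFDerivAt
  have h := (hexp P).mul' (hexp (ContinuousLinearMap.id ℝ 𝔸 - P))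
  -- The derivative at `0` is `P + (1 - P) = 1`, so the inverse function theorem applies.
  have hΦ : HasStrictFDerivAt
      (fun Z : 𝔸 => NormedSpace.exp (P Z) * NormedSpace.exp (Z - P Z))
      ((ContinuousLinearEquiv.refl ℝ 𝔸 : 𝔸 ≃L[ℝ] 𝔸) : 𝔸 →L[ℝ] 𝔸) 0 := by
    have e : NormedSpace.exp (P 0) • (ContinuousLinearMap.id ℝ 𝔸 - P) +
        MulOpposite.op (NormedSpace.exp ((ContinuousLinearMap.id ℝ 𝔸 - P) 0)) • P =
        ((ContinuousLinearEquiv.refl ℝ 𝔸 : 𝔸 ≃L[ℝ] 𝔸) : 𝔸 →L[ℝ] 𝔸) := by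
      ext Z
      simp
    rwa [e] at h
  refine ⟨⟨(hΦ.toOpenPartialHomeomorph _).source, ?_, (hΦ.toOpenPartialHomeomorph _).injOn⟩, ?_⟩
  · exact (hΦ.toOpenPartialHomeomorph _).open_source.mem_nhds
      hΦ.mem_toOpenPartialHomeomorph_source
  · have := hΦ.map_nhds_eq_of_equiv
    simpa using this

theorem matrix_exp_mul_exp_local {m : Type*} [Fintype m] [DecidableEq m]
    (P : Matrix m m ℝ →ₗ[ℝ] Matrix m m ℝ) :
    (∃ U ∈ 𝓝 (0 : Matrix m m ℝ),
      Set.InjOn (fun Z => NormedSpace.exp (P Z) * NormedSpace.exp (Z - P Z)) U) ∧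
    map (fun Z => NormedSpace.exp (P Z) * NormedSpace.exp (Z - P Z)) (𝓝 (0 : Matrix m m ℝ)) =
      𝓝 1 := by
  let _ : NormedRing (Matrix m m ℝ) := Matrix.linftyOpNormedRing
  let _ : NormedAlgebra ℝ (Matrix m m ℝ) := Matrix.linftyOpNormedAlgebra
  exact exp_mul_exp_local (LinearMap.toContinuousLinearMap P)

/-- The entries of a matrix are bounded by its norm for `⟨X, Y⟩ = tr(Xᵀ Y)`. -/
theorem abs_apply_le_sqrt_trace {m : Type*} [Fintype m] (Y : Matrix m m ℝ) (i j : m) :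
    |Y i j| ≤ √((Yᵀ * Y).trace) := by
  refine Real.abs_le_sqrt ?_
  simp only [trace, diag_apply, mul_apply, transpose_apply]
  calc Y i j ^ 2 ≤ ∑ k, Y k j * Y k j := by
        rw [pow_two]
        exact Finset.single_le_sum (f := fun k => Y k j * Y k j) (fun k _ => mul_self_nonneg _)
          (Finset.mem_univ i)
    _ ≤ ∑ l, ∑ k, Y k l * Y k l :=
        Finset.single_le_sum (f := fun l => ∑ k, Y k l * Y k l)
          (fun l _ => Finset.sum_nonneg fun k _ => mul_self_nonneg _) (Finset.mem_univ j)

theorem continuous_sqrt_trace {m : Type*} [Fintype m] :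
    Continuous fun Y : Matrix m m ℝ => √((Yᵀ * Y).trace) := by
  fun_prop

theorem trace_transpose_mul_self_eq_zero {m : Type*} [Fintype m] {Y : Matrix m m ℝ}
    (h : (Yᵀ * Y).trace = 0) : Y = 0 := by
  ext i j
  have := abs_apply_le_sqrt_trace Y i j
  rw [h, Real.sqrt_zero] at this
  exact abs_nonpos_iff.1 this

theorem exists_sqrt_trace_lt_subset {m : Type*} [Fintype m] {U : Set (Matrix m m ℝ)}
    (hU : U ∈ 𝓝 0) : ∃ ε > 0, ∀ Y : Matrix m m ℝ, √((Yᵀ * Y).trace) < ε → Y ∈ U := by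
  let _ : NormedAddCommGroup (Matrix m m ℝ) := Matrix.normedAddCommGroup
  obtain ⟨ε, hε, h⟩ := Metric.mem_nhds_iff.1 hU
  refine ⟨ε, hε, fun Y hY => h ?_⟩
  rw [mem_ball_zero_iff, Matrix.norm_lt_iff hε]
  exact fun i j => (abs_apply_le_sqrt_trace Y i j).trans_lt hY

theorem exp_eq_diagonal_of_isDiag {m : Type*} [Fintype m] [DecidableEq m] {D : Matrix m m ℝ}
    (hD : D.IsDiag) : NormedSpace.exp D = diagonal fun i => Real.exp (D i i) := by
  conv_lhs => rw [← hD.diagonal_diag, Matrix.exp_diagonal]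
  congr 1
  ext i
  rw [Pi.coe_exp, Real.exp_eq_exp_ℝ, diag_apply]

/-- A diagonal matrix is small if its exponential is close to the identity. -/
theorem isDiag_mem_of_exp_mem {m : Type*} [Fintype m] [DecidableEq m] {U : Set (Matrix m m ℝ)}
    (hU : U ∈ 𝓝 0) :
    ∃ V ∈ 𝓝 (1 : Matrix m m ℝ), ∀ D : Matrix m m ℝ, D.IsDiag → NormedSpace.exp D ∈ V → D ∈ U := by
  -- The logarithm of the diagonal inverts `exp` on all diagonal matrices and is continuous at `1`;
  -- no prior smallness of `D` is required.
  have hlog : Tendsto (fun M : Matrix m m ℝ => diagonal fun i => Real.log (M i i)) (𝓝 1) (𝓝 0) := by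
    have hc : ContinuousAt (fun M : Matrix m m ℝ => fun i => Real.log (M i i)) 1 := by
      refine continuousAt_pi.2 fun i => ?_
      refine ContinuousAt.log (continuous_id.matrix_elem i i).continuousAt ?_
      simp
    have h := (Continuous.matrix_diagonal continuous_id).continuousAt.comp
      (f := fun M : Matrix m m ℝ => fun i => Real.log (M i i)) hc
    simpa [ContinuousAt, Function.comp_def] using h
  refine ⟨_, hlog hU, fun D hD hexp => ?_⟩
  have he := exp_eq_diagonal_of_isDiag hD
  have hD' : (diagonal fun i => Real.log (NormedSpace.exp D i i)) = D := by
    conv_rhs => rw [← hD.diagonal_diag]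
    congr 1
    ext i
    rw [he, diagonal_apply_eq, Real.log_exp, diag_apply]
  rw [← hD']
  exact hexp

/-! ### Tubes around commuting one-parameter subgroups -/

/-- The traceless matrices orthogonal to all `H i` and of norm less than `ε`. -/
def crossSection {n : ℕ} {ι : Type*} (H : ι → Matrix (Fin n) (Fin n) ℝ) (ε : ℝ) :
    Set (Matrix (Fin n) (Fin n) ℝ) :=
  {Y | Y.trace = 0 ∧ (∀ i, ((H i)ᵀ * Y).trace = 0) ∧ √((Yᵀ * Y).trace) < ε}

theorem mem_tube_iff {n : ℕ} {ι : Type*} [Fintype ι] {H : ι → Matrix (Fin n) (Fin n) ℝ} {ε : ℝ}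
    {J : Set (ι → ℝ)} {g : SLn n} :
    g ∈ tube H ε J ↔ ∃ t ∈ J, ∃ Y ∈ crossSection H ε, (g : Matrix (Fin n) (Fin n) ℝ) =
      NormedSpace.exp (Fintype.linearCombination ℝ H t) * NormedSpace.exp Y := by
  constructor
  · rintro ⟨t, ht, Y, h1, h2, h3, h4⟩
    exact ⟨t, ht, Y, ⟨h1, h2, h3⟩, h4⟩
  · rintro ⟨t, ht, Y, ⟨h1, h2, h3⟩, h4⟩
    exact ⟨t, ht, Y, h1, h2, h3, h4⟩

theorem tube_mono {n : ℕ} {ι : Type*} [Fintype ι] {H : ι → Matrix (Fin n) (Fin n) ℝ} {ε : ℝ}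
    {J J' : Set (ι → ℝ)} (h : J ⊆ J') : tube H ε J ⊆ tube H ε J' := by
  rintro g ⟨t, ht, hg⟩
  exact ⟨t, h ht, hg⟩

/-- The coordinates of the component of a matrix in the span of linearly independent `H i`. -/
theorem exists_linearCombination_coord {n : ℕ} {ι : Type*} [Fintype ι]
    {H : ι → Matrix (Fin n) (Fin n) ℝ} (hlin : LinearIndependent ℝ H) :
    ∃ τ : Matrix (Fin n) (Fin n) ℝ →ₗ[ℝ] (ι → ℝ),
      (∀ t Y, (∀ i, ((H i)ᵀ * Y).trace = 0) → τ (Fintype.linearCombination ℝ H t + Y) = t) ∧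
      ∀ Z i, ((H i)ᵀ * (Z - Fintype.linearCombination ℝ H (τ Z))).trace = 0 := by
  classical
  let A : Matrix (Fin n) (Fin n) ℝ →ₗ[ℝ] (ι → ℝ) :=
    LinearMap.pi fun i => (Matrix.traceLinearMap (Fin n) ℝ ℝ).comp (LinearMap.mulLeft ℝ (H i)ᵀ)
  have hA : ∀ Z i, A Z i = ((H i)ᵀ * Z).trace := fun Z i => rfl
  -- This endomorphism is the Gram matrix of the `H i`: a vector in its kernel gives a combination
  -- orthogonal to itself, hence zero.
  have hinj : Function.Injective (A.comp (Fintype.linearCombination ℝ H)) := by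
    rw [← LinearMap.ker_eq_bot, LinearMap.ker_eq_bot']
    intro t ht
    have h0 : ∀ i, ((H i)ᵀ * Fintype.linearCombination ℝ H t).trace = 0 := fun i => congrFun ht i
    have h1 : ((Fintype.linearCombination ℝ H t)ᵀ * Fintype.linearCombination ℝ H t).trace = 0 := by
      nth_rw 1 [Fintype.linearCombination_apply]
      rw [transpose_sum, Finset.sum_mul, trace_sum]
      refine Finset.sum_eq_zero fun i _ => ?_
      rw [transpose_smul, smul_mul_assoc, trace_smul, h0, smul_zero]
    have h2 := trace_transpose_mul_self_eq_zero h1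
    rw [Fintype.linearCombination_apply] at h2
    exact funext fun i => Fintype.linearIndependent_iff.1 hlin t h2 i
  let e := LinearEquiv.ofInjectiveEndo _ hinj
  have he : ∀ t, e t = A (Fintype.linearCombination ℝ H t) := fun t => rfl
  refine ⟨e.symm.toLinearMap.comp A, fun t Y hY => ?_, fun Z i => ?_⟩
  · have hAY : A Y = 0 := funext hY
    rw [LinearMap.comp_apply, map_add, hAY, add_zero, ← he]
    exact e.symm_apply_apply t
  · have h : A (Z - Fintype.linearCombination ℝ H (e.symm (A Z))) = 0 := by
      rw [map_sub, ← he, e.apply_symm_apply, sub_self]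
    exact congrFun h i

theorem isDiag_linearCombination {n : ℕ} {ι : Type*} [Fintype ι]
    {H : ι → Matrix (Fin n) (Fin n) ℝ} (hH : ∀ i, (H i).IsDiag) (t : ι → ℝ) :
    (Fintype.linearCombination ℝ H t).IsDiag := by
  intro i j hij
  rw [Fintype.linearCombination_apply, Matrix.sum_apply]
  exact Finset.sum_eq_zero fun k _ => by rw [Matrix.smul_apply, hH k hij, smul_zero]

theorem trace_linearCombination {n : ℕ} {ι : Type*} [Fintype ι]
    {H : ι → Matrix (Fin n) (Fin n) ℝ} (hH : ∀ i, (H i).trace = 0) (t : ι → ℝ) :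
    (Fintype.linearCombination ℝ H t).trace = 0 := by
  rw [Fintype.linearCombination_apply, trace_sum]
  exact Finset.sum_eq_zero fun k _ => by rw [trace_smul, hH k, smul_zero]

theorem exp_linearCombination_add {n : ℕ} {ι : Type*} [Fintype ι]
    {H : ι → Matrix (Fin n) (Fin n) ℝ} (hH : ∀ i, (H i).IsDiag) (s t : ι → ℝ) :
    NormedSpace.exp (Fintype.linearCombination ℝ H (s + t)) =
      NormedSpace.exp (Fintype.linearCombination ℝ H s) *
        NormedSpace.exp (Fintype.linearCombination ℝ H t) := by
  rw [map_add, Matrix.exp_add_of_commute]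
  rw [← (isDiag_linearCombination hH s).diagonal_diag, ← (isDiag_linearCombination hH t).diagonal_diag]
  exact Matrix.commute_diagonal _ _

theorem continuous_linearCombination {n : ℕ} {ι : Type*} [Fintype ι]
    (H : ι → Matrix (Fin n) (Fin n) ℝ) : Continuous (Fintype.linearCombination ℝ H) := by
  have : (Fintype.linearCombination ℝ H : (ι → ℝ) → Matrix (Fin n) (Fin n) ℝ) =
      fun t => ∑ i, t i • H i := funext fun t => Fintype.linearCombination_apply ℝ H t
  rw [this]
  fun_prop

/-- `exp(∑ tᵢ Hᵢ)` as an element of `SL_n(ℝ)`. -/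
def expSL {n : ℕ} {ι : Type*} [Fintype ι] {H : ι → Matrix (Fin n) (Fin n) ℝ}
    (hH : ∀ i, (H i).trace = 0) (t : ι → ℝ) : SLn n :=
  ⟨NormedSpace.exp (Fintype.linearCombination ℝ H t), by
    rw [det_matrix_exp, trace_linearCombination hH, Real.exp_zero]⟩

/-- For small `ε`, a point of the tube of radius `ε` has a unique pair of parameters. -/
theorem exists_tube_param_injective {n : ℕ} {ι : Type*} [Fintype ι]
    {H : ι → Matrix (Fin n) (Fin n) ℝ} (hlin : LinearIndependent ℝ H) (hH : ∀ i, (H i).IsDiag) :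
    ∃ ε > 0, ∀ t t' : ι → ℝ, ∀ Y ∈ crossSection H ε, ∀ Y' ∈ crossSection H ε,
      NormedSpace.exp (Fintype.linearCombination ℝ H t) * NormedSpace.exp Y =
        NormedSpace.exp (Fintype.linearCombination ℝ H t') * NormedSpace.exp Y' →
      t = t' ∧ Y = Y' := by
  obtain ⟨τ, hτ1, -⟩ := exists_linearCombination_coord hlin
  obtain ⟨⟨U, hU, hinj⟩, -⟩ := matrix_exp_mul_exp_local
    ((Fintype.linearCombination ℝ H).comp τ)
  have hadd : Tendsto (fun p : Matrix (Fin n) (Fin n) ℝ × Matrix (Fin n) (Fin n) ℝ => p.1 + p.2)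
      (𝓝 0 ×ˢ 𝓝 0) (𝓝 0) := by
    have h := (continuous_add (M := Matrix (Fin n) (Fin n) ℝ)).tendsto (0, 0)
    rwa [nhds_prod_eq, add_zero] at h
  obtain ⟨U₁, hU₁, hU₁U⟩ := mem_prod_same_iff.1 (hadd hU)
  obtain ⟨V, hV, hVU⟩ := isDiag_mem_of_exp_mem hU₁
  have hexp : Tendsto (fun p : Matrix (Fin n) (Fin n) ℝ × Matrix (Fin n) (Fin n) ℝ =>
      NormedSpace.exp p.2 * NormedSpace.exp (-p.1)) (𝓝 0 ×ˢ 𝓝 0) (𝓝 1) := by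
    have hc : Continuous fun p : Matrix (Fin n) (Fin n) ℝ × Matrix (Fin n) (Fin n) ℝ =>
        NormedSpace.exp p.2 * NormedSpace.exp (-p.1) :=
      (continuous_matrix_exp.comp continuous_snd).mul
        (continuous_matrix_exp.comp continuous_fst.neg)
    have h := hc.tendsto (0, 0)
    simpa [nhds_prod_eq] using h
  obtain ⟨W, hW, hWV⟩ := mem_prod_same_iff.1 (hexp hV)
  obtain ⟨ε, hε, hεW⟩ := exists_sqrt_trace_lt_subset
    (inter_mem hW (inter_mem hU₁ hU))
  refine ⟨ε, hε, fun t t' Y hY Y' hY' h => ?_⟩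
  have hYm := hεW Y hY.2.2
  have hYm' := hεW Y' hY'.2.2
  -- A coincidence gives `exp(∑ (tᵢ - t'ᵢ) Hᵢ) = exp(Y') exp(-Y)`, which is near `1`. The diagonal
  -- exponent is then small whatever `t` and `t'` are, and local injectivity near `0` applies.
  have h1 : NormedSpace.exp (Fintype.linearCombination ℝ H (-t' + t)) * NormedSpace.exp Y =
      NormedSpace.exp Y' := by
    rw [exp_linearCombination_add hH, mul_assoc, h, ← mul_assoc, ← exp_linearCombination_add hH,
      neg_add_cancel, map_zero, NormedSpace.exp_zero, one_mul]
  have h2 : NormedSpace.exp (Fintype.linearCombination ℝ H (-t' + t)) =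
      NormedSpace.exp Y' * NormedSpace.exp (-Y) := by
    rw [← h1, mul_assoc, ← Matrix.exp_add_of_commute _ _ (Commute.refl Y).neg_right, add_neg_cancel,
      NormedSpace.exp_zero, mul_one]
  have h3 : Fintype.linearCombination ℝ H (-t' + t) ∈ U₁ := by
    refine hVU _ (isDiag_linearCombination hH _) ?_
    rw [h2]
    exact hWV (Set.mk_mem_prod hYm.1 hYm'.1)
  have h4 : Fintype.linearCombination ℝ H (-t' + t) + Y ∈ U :=
    hU₁U (Set.mk_mem_prod h3 hYm.2.1)
  have hτ0 : τ Y' = 0 := by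
    have := hτ1 0 Y' hY'.2.1
    rwa [map_zero, zero_add] at this
  have h5 := hinj h4 hYm'.2.2 (by
    simp only [LinearMap.comp_apply, hτ1 _ Y hY.2.1, hτ0, map_zero, NormedSpace.exp_zero, one_mul,
      add_sub_cancel_left, sub_zero]
    exact h1)
  have h6 : -t' + t = 0 := by
    rw [← hτ1 (-t' + t) Y hY.2.1, h5, hτ0]
  refine ⟨(neg_add_eq_zero.1 h6).symm, ?_⟩
  rwa [h6, map_zero, zero_add] at h5

/-- The tube over a neighborhood of `0` is a neighborhood of the identity. -/
theorem tube_mem_nhds_one {n : ℕ} {ι : Type*} [Fintype ι]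
    {H : ι → Matrix (Fin n) (Fin n) ℝ} (hlin : LinearIndependent ℝ H) (hH : ∀ i, (H i).trace = 0)
    {ε : ℝ} (hε : 0 < ε) {J : Set (ι → ℝ)} (hJ : J ∈ 𝓝 0) : tube H ε J ∈ 𝓝 (1 : SLn n) := by
  obtain ⟨τ, -, hτ2⟩ := exists_linearCombination_coord hlin
  obtain ⟨-, hmap⟩ := matrix_exp_mul_exp_local ((Fintype.linearCombination ℝ H).comp τ)
  have hτc : Continuous τ := by
    have h : Continuous fun x : Fin n × Fin n → ℝ => τ (ofEntries x) :=
      LinearMap.continuous_on_pi (τ.comp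
        ({ toFun := ofEntries, map_add' := fun _ _ => rfl, map_smul' := fun _ _ => rfl } :
          (Fin n × Fin n → ℝ) →ₗ[ℝ] Matrix (Fin n) (Fin n) ℝ))
    exact h.comp continuous_entries
  have hLc := (continuous_linearCombination H).comp hτc
  have h1 : ∀ᶠ Z in 𝓝 (0 : Matrix (Fin n) (Fin n) ℝ), τ Z ∈ J :=
    hτc.tendsto' 0 0 (map_zero τ) hJ
  have h2 : ∀ᶠ Z in 𝓝 (0 : Matrix (Fin n) (Fin n) ℝ),
      √(((Z - Fintype.linearCombination ℝ H (τ Z))ᵀ *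
        (Z - Fintype.linearCombination ℝ H (τ Z))).trace) < ε := by
    have hc : Continuous fun Z : Matrix (Fin n) (Fin n) ℝ =>
        √(((Z - Fintype.linearCombination ℝ H (τ Z))ᵀ *
          (Z - Fintype.linearCombination ℝ H (τ Z))).trace) :=
      continuous_sqrt_trace.comp (continuous_id.sub hLc)
    refine hc.tendsto' 0 0 (by simp) (Iio_mem_nhds hε)
  have h3 := image_mem_map (h1.and h2) (m := fun Z =>
    NormedSpace.exp ((Fintype.linearCombination ℝ H).comp τ Z) *
      NormedSpace.exp (Z - (Fintype.linearCombination ℝ H).comp τ Z))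
  rw [hmap] at h3
  have h4 : Continuous fun g : SLn n => (g : Matrix (Fin n) (Fin n) ℝ) := continuous_subtype_val
  filter_upwards [h4.tendsto' 1 1 rfl h3] with g hg
  obtain ⟨Z, ⟨hZ1, hZ2⟩, hZg⟩ := hg
  refine mem_tube_iff.2 ⟨τ Z, hZ1, Z - Fintype.linearCombination ℝ H (τ Z), ⟨?_, hτ2 Z, hZ2⟩,
    hZg.symm⟩
  -- Determinant one forces the transverse component to be traceless, since `det (exp Y) = exp (tr
  -- Y)`.
  have hdet := g.det_coe
  have hZg' : NormedSpace.exp (Fintype.linearCombination ℝ H (τ Z)) *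
    NormedSpace.exp (Z - Fintype.linearCombination ℝ H (τ Z)) =
      (g : Matrix (Fin n) (Fin n) ℝ) := hZg
  rw [← hZg', det_mul, det_matrix_exp, det_matrix_exp, trace_linearCombination hH, Real.exp_zero,
    one_mul, Real.exp_eq_one_iff] at hdet
  exact hdet

theorem measurableSet_crossSection {n : ℕ} {ι : Type*} [Fintype ι]
    (H : ι → Matrix (Fin n) (Fin n) ℝ) (ε : ℝ) :
    MeasurableSet {x : Fin n × Fin n → ℝ | ofEntries x ∈ crossSection H ε} := by
  have h1 : MeasurableSet {x : Fin n × Fin n → ℝ | (ofEntries x).trace = 0} :=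
    (isClosed_eq continuous_ofEntries.matrix_trace continuous_const).measurableSet
  have h2 : MeasurableSet (⋂ i, {x : Fin n × Fin n → ℝ | ((H i)ᵀ * ofEntries x).trace = 0}) :=
    MeasurableSet.iInter fun i => (isClosed_eq (continuous_const.matrix_mul
      continuous_ofEntries).matrix_trace continuous_const).measurableSet
  have h3 : MeasurableSet {x : Fin n × Fin n → ℝ | √(((ofEntries x)ᵀ * ofEntries x).trace) < ε} :=
    (isOpen_lt (continuous_sqrt_trace.comp continuous_ofEntries) continuous_const).measurableSet
  have h := h1.inter (h2.inter h3)
  convert h using 1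
  ext x
  simp [crossSection]

/-- An injective continuous image of a Borel set is Borel (Lusin–Souslin), which is why injectivity
of the parametrization is assumed. -/
theorem measurableSet_tube {n : ℕ} {ι : Type*} [Fintype ι]
    {H : ι → Matrix (Fin n) (Fin n) ℝ} {ε : ℝ}
    (hinj : ∀ t t' : ι → ℝ, ∀ Y ∈ crossSection H ε, ∀ Y' ∈ crossSection H ε,
      NormedSpace.exp (Fintype.linearCombination ℝ H t) * NormedSpace.exp Y =
        NormedSpace.exp (Fintype.linearCombination ℝ H t') * NormedSpace.exp Y' →
      t = t' ∧ Y = Y') {J : Set (ι → ℝ)} (hJ : MeasurableSet J) : MeasurableSet (tube H ε J) := by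
  let f : (ι → ℝ) × (Fin n × Fin n → ℝ) → (Fin n × Fin n → ℝ) := fun q =>
    entries (NormedSpace.exp (Fintype.linearCombination ℝ H q.1) *
      NormedSpace.exp (ofEntries q.2))
  have hf : Continuous f := continuous_entries.comp
    ((continuous_matrix_exp.comp ((continuous_linearCombination H).comp continuous_fst)).mul
      (continuous_matrix_exp.comp (continuous_ofEntries.comp continuous_snd)))
  have hS := hJ.prod (measurableSet_crossSection H ε)
  have himg := hS.image_of_continuousOn_injOn hf.continuousOn (by
    rintro ⟨t, x⟩ hx ⟨t', x'⟩ hx' h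
    have h' := congrArg ofEntries h
    obtain ⟨h1, h2⟩ := hinj t t' _ hx.2 _ hx'.2 h'
    exact Prod.ext h1 (congrArg entries h2))
  have hpre := (isClosedEmbedding_entries_SLn n).continuous.measurable himg
  convert hpre using 1
  ext g
  rw [mem_tube_iff]
  constructor
  · rintro ⟨t, ht, Y, hY, hg⟩
    exact ⟨(t, entries Y), ⟨ht, hY⟩, congrArg entries hg.symm⟩
  · rintro ⟨⟨t, x⟩, ⟨ht, hx⟩, hg⟩
    exact ⟨t, ht, ofEntries x, hx, (congrArg ofEntries hg).symm⟩

/-- Diagonal matrices commute, so left translation by `exp(∑ sᵢ Hᵢ)` shifts the base of a tube and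
keeps its cross-section. -/
theorem tube_preimage_add {n : ℕ} {ι : Type*} [Fintype ι]
    {H : ι → Matrix (Fin n) (Fin n) ℝ} (hH : ∀ i, (H i).IsDiag) (hH' : ∀ i, (H i).trace = 0)
    (ε : ℝ) (s : ι → ℝ) (J : Set (ι → ℝ)) :
    tube H ε ((fun t => s + t) ⁻¹' J) = (fun g => expSL hH' s * g) ⁻¹' tube H ε J := by
  ext g
  rw [Set.mem_preimage, mem_tube_iff, mem_tube_iff]
  have hc : ((expSL hH' s * g : SLn n) : Matrix (Fin n) (Fin n) ℝ) =
    NormedSpace.exp (Fintype.linearCombination ℝ H s) * (g : Matrix (Fin n) (Fin n) ℝ) := rfl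
  rw [hc]
  constructor
  · rintro ⟨t, ht, Y, hY, hg⟩
    refine ⟨s + t, ht, Y, hY, ?_⟩
    rw [exp_linearCombination_add hH, hg, mul_assoc]
  · rintro ⟨t, ht, Y, hY, hg⟩
    refine ⟨-s + t, by simpa using ht, Y, hY, ?_⟩
    rw [exp_linearCombination_add hH, mul_assoc, ← hg, ← mul_assoc, ← exp_linearCombination_add hH,
      neg_add_cancel, map_zero, NormedSpace.exp_zero, one_mul]

theorem measure_tube_lt_top {n : ℕ} {ι : Type*} [Fintype ι]
    (H : ι → Matrix (Fin n) (Fin n) ℝ) (ε : ℝ) (μ : Measure (SLn n)) [IsFiniteMeasureOnCompacts μ]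
    {K : Set (ι → ℝ)} (hK : IsCompact K) : μ (tube H ε K) < ⊤ := by
  let f : (ι → ℝ) × (Fin n × Fin n → ℝ) → (Fin n × Fin n → ℝ) := fun q =>
    entries (NormedSpace.exp (Fintype.linearCombination ℝ H q.1) *
      NormedSpace.exp (ofEntries q.2))
  have hf : Continuous f := continuous_entries.comp
    ((continuous_matrix_exp.comp ((continuous_linearCombination H).comp continuous_fst)).mul
      (continuous_matrix_exp.comp (continuous_ofEntries.comp continuous_snd)))
  have hC := (hK.prod (isCompact_univ_pi fun _ : Fin n × Fin n =>
    isCompact_Icc (a := -ε) (b := ε))).image hf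
  refine lt_of_le_of_lt (measure_mono fun g hg => ?_)
    ((isClosedEmbedding_entries_SLn n).isCompact_preimage hC).measure_lt_top
  obtain ⟨t, ht, Y, hY, hg⟩ := mem_tube_iff.1 hg
  refine ⟨(t, entries Y), ⟨ht, fun p _ => ?_⟩, congrArg entries hg.symm⟩
  exact abs_le.1 ((abs_apply_le_sqrt_trace Y p.1 p.2).trans hY.2.2.le)

/-- For small `ε`, the measure of a tube is proportional to the volume of its base. -/
theorem exists_measure_tube_eq {n : ℕ} {ι : Type*} [Fintype ι]
    {H : ι → Matrix (Fin n) (Fin n) ℝ} (hlin : LinearIndependent ℝ H)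
    (hH : ∀ i, (H i).IsDiag ∧ (H i).trace = 0) (μ : Measure (SLn n)) [μ.IsHaarMeasure] :
    ∃ ε₀ > 0, ∀ ε, 0 < ε → ε ≤ ε₀ → ∃ c : NNReal, c ≠ 0 ∧ ∀ J : Set (ι → ℝ), MeasurableSet J →
      μ (tube H ε J) = c * volume J := by
  obtain ⟨ε₀, hε₀, hinj₀⟩ := exists_tube_param_injective hlin fun i => (hH i).1
  refine ⟨ε₀, hε₀, fun ε hε hεε₀ => ?_⟩
  have hinj : ∀ t t' : ι → ℝ, ∀ Y ∈ crossSection H ε, ∀ Y' ∈ crossSection H ε,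
      NormedSpace.exp (Fintype.linearCombination ℝ H t) * NormedSpace.exp Y =
        NormedSpace.exp (Fintype.linearCombination ℝ H t') * NormedSpace.exp Y' →
      t = t' ∧ Y = Y' := fun t t' Y hY Y' hY' =>
    hinj₀ t t' Y ⟨hY.1, hY.2.1, hY.2.2.trans_le hεε₀⟩ Y' ⟨hY'.1, hY'.2.1, hY'.2.2.trans_le hεε₀⟩
  classical
  let T : Set (SLn n) := tube H ε Set.univ
  -- `p` reads off the base parameter of a point of the tube; its value `0` outside `T` is
  -- irrelevant, because `μ` is restricted to `T`.
  let p : SLn n → (ι → ℝ) := fun g => if h : g ∈ T then (mem_tube_iff.1 h).choose else 0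
  have hp : ∀ J : Set (ι → ℝ), p ⁻¹' J ∩ T = tube H ε J := by
    intro J
    ext g
    constructor
    · rintro ⟨hgJ, hgT⟩
      obtain ⟨-, Y, hY, hg⟩ := (mem_tube_iff.1 hgT).choose_spec
      refine mem_tube_iff.2 ⟨_, ?_, Y, hY, hg⟩
      have : p g = (mem_tube_iff.1 hgT).choose := dif_pos hgT
      rw [← this]
      exact hgJ
    · intro hgJ
      have hgT : g ∈ T := tube_mono (Set.subset_univ J) hgJ
      refine ⟨?_, hgT⟩
      obtain ⟨-, Y, hY, hg⟩ := (mem_tube_iff.1 hgT).choose_spec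
      obtain ⟨t, ht, Y', hY', hg'⟩ := mem_tube_iff.1 hgJ
      have hpg : p g = (mem_tube_iff.1 hgT).choose := dif_pos hgT
      rw [Set.mem_preimage, hpg, (hinj _ _ Y hY Y' hY' (hg.symm.trans hg')).1]
      exact ht
  have hT : MeasurableSet T := measurableSet_tube hinj MeasurableSet.univ
  have hpm : Measurable p := by
    refine measurable_of_restrict_of_restrict_compl hT ?_ ?_
    · intro J hJ
      have : T.domRestrict p ⁻¹' J = Subtype.val ⁻¹' tube H ε J := by
        rw [← hp J]
        ext g
        simp
      rw [this]
      exact measurable_subtype_coe (measurableSet_tube hinj hJ)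
    · have : Tᶜ.domRestrict p = fun _ => 0 := funext fun g => dif_neg g.2
      rw [this]
      exact measurable_const
  let ν : Measure (ι → ℝ) := Measure.map p (μ.restrict T)
  have hν : ∀ J : Set (ι → ℝ), MeasurableSet J → ν J = μ (tube H ε J) := by
    intro J hJ
    rw [Measure.map_apply hpm hJ, Measure.restrict_apply (hpm hJ), hp]
  have hνinv : ν.IsAddLeftInvariant := by
    refine ⟨fun s => Measure.ext fun J hJ => ?_⟩
    rw [Measure.map_apply (measurable_const_add s) hJ, hν _ (measurable_const_add s hJ), hν J hJ,
      tube_preimage_add (fun i => (hH i).1) (fun i => (hH i).2), measure_preimage_mul]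
  have hνfin : IsFiniteMeasureOnCompacts ν :=
    ⟨fun K hK => by rw [hν K hK.measurableSet]; exact measure_tube_lt_top H ε μ hK⟩
  -- By uniqueness of Haar measure on `ℝ^ι`, `ν` is a multiple of Lebesgue measure. The factor is
  -- nonzero because the full tube is a neighborhood of the identity.
  have hvol := Measure.isAddLeftInvariant_eq_smul ν (volume : Measure (ι → ℝ))
  refine ⟨ν.addHaarScalarFactor volume, fun h0 => ?_, fun J hJ => ?_⟩
  · rw [h0, zero_smul] at hvol
    have h1 : μ T = 0 := by rw [← hν _ MeasurableSet.univ, hvol]; rfl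
    have h2 : T ∈ 𝓝 (1 : SLn n) := tube_mem_nhds_one hlin (fun i => (hH i).2) hε univ_mem
    exact (Measure.measure_pos_of_mem_nhds μ h2).ne' h1
  · rw [← hν J hJ]
    conv_lhs => rw [hvol]
    rfl

/-! ### Digit laws -/

theorem integral_benfordDensity {B s : ℝ} (hs : 1 ≤ s) :
    ∫ x in (1 : ℝ)..s, benfordDensity B x = Real.log s / Real.log B := by
  have h : ∀ x, benfordDensity B x = (Real.log B)⁻¹ * x⁻¹ := fun x => by
    rw [benfordDensity, one_div, mul_inv]
  simp only [h]
  rw [intervalIntegral.integral_const_mul, integral_inv_of_pos one_pos (by linarith), div_one]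
  ring

theorem logCell_eq_pi {ι : Type*} (B : ℝ) (l : ι → ℕ) (s : ι → ℝ) :
    logCell B l s = Set.univ.pi fun i => Set.Ico (Real.log (B ^ l i)) (Real.log (B ^ l i * s i)) := by
  ext t; simp [logCell]

theorem logCube_eq_pi (ι : Type*) (B : ℝ) (k : ℕ) :
    logCube ι B k = Set.univ.pi fun _ => Set.Ico 0 (k * Real.log B) := by
  ext t; simp [logCube]

theorem volume_real_logCell {ι : Type*} [Fintype ι] {B : ℝ} (hB : 1 < B) (l : ι → ℕ) {s : ι → ℝ}
    (hs : ∀ i, 1 ≤ s i) : volume.real (logCell B l s) = ∏ i, Real.log (s i) := by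
  rw [logCell_eq_pi, measureReal_def, volume_pi_pi, ENNReal.toReal_prod]
  refine Finset.prod_congr rfl fun i _ => ?_
  have hB0 : B ^ l i ≠ 0 := pow_ne_zero _ (by linarith)
  have hs0 : s i ≠ 0 := by linarith [hs i]
  rw [Real.volume_Ico, Real.log_mul hB0 hs0, add_sub_cancel_left,
    ENNReal.toReal_ofReal (Real.log_nonneg (hs i))]

theorem volume_real_logCube {ι : Type*} [Fintype ι] {B : ℝ} (hB : 1 < B) (k : ℕ) :
    volume.real (logCube ι B k) = ∏ _i : ι, (k * Real.log B) := by
  rw [logCube_eq_pi, measureReal_def, volume_pi_pi, ENNReal.toReal_prod]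
  refine Finset.prod_congr rfl fun i _ => ?_
  rw [Real.volume_Ico, sub_zero, ENNReal.toReal_ofReal]
  exact mul_nonneg k.cast_nonneg (Real.log_nonneg hB.le)

theorem measurableSet_logCell {ι : Type*} [Fintype ι] (B : ℝ) (l : ι → ℕ) (s : ι → ℝ) :
    MeasurableSet (logCell B l s) := by
  rw [logCell_eq_pi]; exact MeasurableSet.univ_pi fun _ => measurableSet_Ico

theorem measurableSet_logCube (ι : Type*) [Fintype ι] (B : ℝ) (k : ℕ) :
    MeasurableSet (logCube ι B k) := by
  rw [logCube_eq_pi]; exact MeasurableSet.univ_pi fun _ => measurableSet_Ico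

theorem measureReal_tube_eq {n : ℕ} {ι : Type*} [Fintype ι] {H : ι → Matrix (Fin n) (Fin n) ℝ}
    {μ : Measure (SLn n)} {ε : ℝ} {c : NNReal} {J : Set (ι → ℝ)}
    (h : μ (tube H ε J) = c * volume J) : μ.real (tube H ε J) = c * volume.real J := by
  rw [measureReal_def, h, ENNReal.toReal_mul, measureReal_def, ENNReal.coe_toReal]

/-- For `k > 0` and small `ε` the ratio is exactly `k^|ι| ∏ log sᵢ / (k log B)^|ι|`: the constant of
the tube cancels and both limits are limits of constants. -/
theorem hasJointDigitLaw_benford {n : ℕ} {ι : Type*} [Fintype ι] [DecidableEq ι]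
    {H : ι → Matrix (Fin n) (Fin n) ℝ} (hlin : LinearIndependent ℝ H)
    (hH : ∀ i, (H i).IsDiag ∧ (H i).trace = 0) (μ : Measure (SLn n)) [μ.IsHaarMeasure] {B : ℝ}
    (hB : 1 < B) : HasJointDigitLaw μ B H fun _ => benfordDensity B := by
  intro s hs
  obtain ⟨ε₀, hε₀, hc⟩ := exists_measure_tube_eq hlin hH μ
  refine ⟨fun _ => _, fun k hk => ?_, tendsto_const_nhds⟩
  refine tendsto_const_nhds.congr' ?_
  filter_upwards [Ioc_mem_nhdsGT hε₀] with ε hε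
  obtain ⟨c, hc0, hc⟩ := hc ε hε.1 hε.2
  simp only [measureReal_tube_eq (hc _ (measurableSet_logCell _ _ _)),
    measureReal_tube_eq (hc _ (measurableSet_logCube _ _ _)),
    volume_real_logCell hB _ fun i => (hs i).1, volume_real_logCube hB]
  rw [Finset.sum_const, Finset.card_univ, Fintype.card_fun, Fintype.card_fin, nsmul_eq_mul,
    Nat.cast_pow, ← Finset.card_univ, ← Finset.prod_const, mul_left_comm,
    mul_div_mul_left _ _ (NNReal.coe_ne_zero.2 hc0), ← Finset.prod_mul_distrib,
    ← Finset.prod_div_distrib]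
  refine Finset.prod_congr rfl fun i _ => ?_
  rw [integral_benfordDensity (hs i).1, mul_div_mul_left _ _ (Nat.cast_ne_zero.2 hk.ne')]

/-! ### Significands of perturbed exponentials -/

/-- On the logarithmic scale the significand is the position of `x` modulo `log B`. -/
theorem significand_exp {B : ℝ} (hB : 1 < B) (x : ℝ) :
    significand B (Real.exp x) = Real.exp (x - ⌊x / Real.log B⌋ * Real.log B) := by
  rw [significand, abs_of_pos (Real.exp_pos x), Real.logb, Real.log_exp, Real.exp_sub,
    ← Real.rpow_intCast, Real.rpow_def_of_pos (by linarith), mul_comm (Real.log B)]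

/-- The logarithms in `[0, kL)` whose position modulo `L` is in `[0, a]`, up to an error `η`. -/
def outerCells (L a : ℝ) (k : ℕ) (η : ℝ) : Set ℝ :=
  (⋃ l ∈ Finset.range k, Set.Icc (l * L - η) (l * L + a + η)) ∪ Set.Icc (k * L - η) (k * L)

/-- The logarithms in `[0, kL)` whose position modulo `L` is in `[0, a]` with a margin `η`. -/
def innerCells (L a : ℝ) (k : ℕ) (η : ℝ) : Set ℝ :=
  ⋃ l ∈ Finset.range k, Set.Ico (l * L + η) (l * L + a - η)

theorem measurableSet_outerCells (L a : ℝ) (k : ℕ) (η : ℝ) :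
    MeasurableSet (outerCells L a k η) :=
  (Finset.measurableSet_biUnion _ fun _ _ => measurableSet_Icc).union measurableSet_Icc

theorem measurableSet_innerCells (L a : ℝ) (k : ℕ) (η : ℝ) :
    MeasurableSet (innerCells L a k η) :=
  Finset.measurableSet_biUnion _ fun _ _ => measurableSet_Ico

theorem volume_outerCells_le (L : ℝ) {a η : ℝ} (ha : 0 ≤ a) (k : ℕ) (hη : 0 ≤ η) :
    volume (outerCells L a k η) ≤ ENNReal.ofReal (k * (a + 2 * η) + η) := by
  calc volume (outerCells L a k η)
      ≤ (∑ l ∈ Finset.range k, volume (Set.Icc (l * L - η) (l * L + a + η))) +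
          volume (Set.Icc (k * L - η) (k * L)) :=
        (measure_union_le _ _).trans (add_le_add_left (measure_biUnion_finset_le _ _) _)
    _ = ENNReal.ofReal (k * (a + 2 * η) + η) := by
        have h : ∀ l : ℕ, (l * L + a + η) - (l * L - η) = a + 2 * η := fun l => by ring
        simp only [Real.volume_Icc, h, sub_sub_cancel]
        rw [Finset.sum_const, Finset.card_range, nsmul_eq_mul,
          ENNReal.ofReal_add (by positivity) hη, ENNReal.ofReal_mul (by positivity),
          ENNReal.ofReal_natCast]

theorem volume_innerCells {L a η : ℝ} (haL : a < L) (k : ℕ) (hη : 0 ≤ η) :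
    volume (innerCells L a k η) = ENNReal.ofReal (k * (a - 2 * η)) := by
  rw [innerCells, measure_biUnion_finset _ fun _ _ => measurableSet_Ico]
  · have h : ∀ l : ℕ, (l * L + a - η) - (l * L + η) = a - 2 * η := fun l => by ring
    simp only [Real.volume_Ico, h]
    rw [Finset.sum_const, Finset.card_range, nsmul_eq_mul, ENNReal.ofReal_mul (by positivity),
      ENNReal.ofReal_natCast]
  · have key : ∀ l l' : ℕ, l < l' → Disjoint (Set.Ico (l * L + η) (l * L + a - η))
        (Set.Ico (l' * L + η) (l' * L + a - η)) := by
      intro l l' h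
      rw [Set.disjoint_left]
      rintro x ⟨hx1, hx2⟩ ⟨hx3, hx4⟩
      have h1 : ((l : ℝ) + 1) ≤ l' := by exact_mod_cast h
      have h2 : 0 < L := by linarith
      nlinarith
    intro l _ l' _ hne
    rcases lt_or_gt_of_ne hne with h | h
    exacts [key l l' h, (key l' l h).symm]

/-- A perturbation below `0` would land at a position above `a`, since `η < L - a`. At the other
end, `t + u` may cross `k L`; the extra interval in `outerCells` catches this case. -/
theorem mem_outerCells {L a η t u : ℝ} (k : ℕ) (hηL : η < L - a) (ha : 0 ≤ a) (hη : 0 ≤ η)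
    (ht : t ∈ Set.Ico 0 (k * L)) (hu : |u| ≤ η)
    (h : t + u - ⌊(t + u) / L⌋ * L ≤ a) : t ∈ outerCells L a k η := by
  have hL : 0 < L := by linarith
  obtain ⟨hu1, hu2⟩ := abs_le.1 hu
  have hf := Int.floor_le ((t + u) / L)
  have hf' := Int.lt_floor_add_one ((t + u) / L)
  rw [le_div_iff₀ hL] at hf
  rw [div_lt_iff₀ hL] at hf'
  have h0 : (0 : ℤ) ≤ ⌊(t + u) / L⌋ := by
    by_contra hneg
    have : ⌊(t + u) / L⌋ ≤ -1 := by omega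
    have h1 : ((⌊(t + u) / L⌋ : ℤ) : ℝ) ≤ -1 := by exact_mod_cast this
    nlinarith [ht.1]
  obtain ⟨l, hl⟩ := Int.eq_ofNat_of_zero_le h0
  rw [hl] at h hf hf'
  push_cast at h hf hf'
  rcases lt_trichotomy l k with hlk | rfl | hlk
  · exact Or.inl (Set.mem_biUnion (Finset.mem_coe.2 (Finset.mem_range.2 hlk))
      ⟨by linarith, by linarith⟩)
  · exact Or.inr ⟨by linarith, ht.2.le⟩
  · exfalso
    have h1 : (k : ℝ) + 1 ≤ l := by exact_mod_cast hlk
    nlinarith [ht.2]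

theorem mem_Ico_of_mem_innerCells {L a η t : ℝ} {k : ℕ} (haL : a < L) (ha : 0 ≤ a) (hη : 0 ≤ η)
    (ht : t ∈ innerCells L a k η) : t ∈ Set.Ico 0 (k * L) := by
  simp only [innerCells, Set.mem_iUnion, Finset.mem_range] at ht
  obtain ⟨l, hl, h1, h2⟩ := ht
  have h3 : (l : ℝ) + 1 ≤ k := by exact_mod_cast hl
  have h4 : (0 : ℝ) ≤ l := l.cast_nonneg
  have hL : 0 < L := by linarith
  have h5 : 0 ≤ l * L := by positivity
  exact ⟨by linarith, by nlinarith⟩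

/-- The margin keeps `t + u` inside `[l L, l L + a]`, so with `a < L` the floor is `l`. -/
theorem sub_floor_le_of_mem_innerCells {L a η t u : ℝ} {k : ℕ} (haL : a < L) (ha : 0 ≤ a)
    (ht : t ∈ innerCells L a k η) (hu : |u| ≤ η) : t + u - ⌊(t + u) / L⌋ * L ≤ a := by
  simp only [innerCells, Set.mem_iUnion, Finset.mem_range] at ht
  obtain ⟨l, hl, h1, h2⟩ := ht
  have hL : 0 < L := by linarith
  obtain ⟨hu1, hu2⟩ := abs_le.1 hu
  have hfl : ⌊(t + u) / L⌋ = (l : ℤ) := by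
    rw [Int.floor_eq_iff, le_div_iff₀ hL, div_lt_iff₀ hL]
    push_cast
    exact ⟨by linarith, by linarith⟩
  rw [hfl]
  push_cast
  linarith

/-! ### The joint law of the diagonal entries -/

theorem isDiag_diagDirection {n : ℕ} (m : Fin n) (i : {i : Fin n // i ≠ m}) :
    (diagDirection m i).IsDiag := by
  intro j k hjk
  have h : ∀ l : Fin n, Matrix.single l l (1 : ℝ) j k = 0 := fun l =>
    Matrix.single_apply_of_ne _ _ _ _ _ (by rintro ⟨rfl, rfl⟩; exact hjk rfl)
  rw [diagDirection, Matrix.sub_apply, h, h, sub_zero]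

theorem trace_diagDirection {n : ℕ} (m : Fin n) (i : {i : Fin n // i ≠ m}) :
    (diagDirection m i).trace = 0 := by
  rw [diagDirection, trace_sub, trace_single_eq_same, trace_single_eq_same, sub_self]

theorem linearCombination_diagDirection_apply {n : ℕ} (m : Fin n) (t : {i : Fin n // i ≠ m} → ℝ)
    (i : {i : Fin n // i ≠ m}) :
    Fintype.linearCombination ℝ (diagDirection m) t i.1 i.1 = t i := by
  rw [Fintype.linearCombination_apply, Matrix.sum_apply, Finset.sum_eq_single i]
  · rw [Matrix.smul_apply, diagDirection, Matrix.sub_apply, single_apply_same,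
      single_apply_of_ne _ _ _ _ _ (fun h => i.2 h.1.symm), sub_zero, smul_eq_mul, mul_one]
  · intro j _ hj
    rw [Matrix.smul_apply, diagDirection, Matrix.sub_apply,
      single_apply_of_ne _ _ _ _ _ (fun h => hj (Subtype.ext h.1)),
      single_apply_of_ne _ _ _ _ _ (fun h => i.2 h.1.symm), sub_zero, smul_zero]
  · simp

theorem linearIndependent_diagDirection {n : ℕ} (m : Fin n) :
    LinearIndependent ℝ (diagDirection m) := by
  rw [Fintype.linearIndependent_iff]
  intro t ht i
  rw [← linearCombination_diagDirection_apply m t i, Fintype.linearCombination_apply, ht]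
  rfl

theorem exp_mul_exp_diagDirection_apply {n : ℕ} (m : Fin n) (t : {i : Fin n // i ≠ m} → ℝ)
    (Y : Matrix (Fin n) (Fin n) ℝ) (i : {i : Fin n // i ≠ m}) :
    (NormedSpace.exp (Fintype.linearCombination ℝ (diagDirection m) t) * NormedSpace.exp Y) i.1 i.1 =
      Real.exp (t i) * NormedSpace.exp Y i.1 i.1 := by
  rw [exp_eq_diagonal_of_isDiag (isDiag_linearCombination (isDiag_diagDirection m) t),
    diagonal_mul, linearCombination_diagDirection_apply]

/-- The diagonal entries of `exp Y` are close to `1` for small `Y`. -/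
theorem exists_abs_log_exp_apply_le {n : ℕ} {η : ℝ} (hη : 0 < η) :
    ∃ ε > 0, ∀ Y : Matrix (Fin n) (Fin n) ℝ, √((Yᵀ * Y).trace) < ε →
      ∀ i : Fin n, 0 < NormedSpace.exp Y i i ∧ |Real.log (NormedSpace.exp Y i i)| ≤ η := by
  have h : ∀ i : Fin n, ∀ᶠ Y : Matrix (Fin n) (Fin n) ℝ in 𝓝 0,
      0 < NormedSpace.exp Y i i ∧ |Real.log (NormedSpace.exp Y i i)| ≤ η := by
    intro i
    have hc : Tendsto (fun Y : Matrix (Fin n) (Fin n) ℝ => NormedSpace.exp Y i i) (𝓝 0) (𝓝 1) :=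
      (continuous_matrix_exp.matrix_elem i i).tendsto' 0 1 (by simp)
    have hlog : Tendsto (fun Y : Matrix (Fin n) (Fin n) ℝ => |Real.log (NormedSpace.exp Y i i)|)
        (𝓝 0) (𝓝 0) := by
      simpa using (hc.log one_ne_zero).abs
    exact (hc.eventually (lt_mem_nhds one_pos)).and (hlog.eventually (ge_mem_nhds hη))
  exact exists_sqrt_trace_lt_subset (eventually_all.2 h)

/-- Two-sided bounds for the proportion of a thin tube in which the diagonal entries have small
significands. -/
theorem diagonalDigit_bounds {n : ℕ} (μ : Measure (SLn n)) [μ.IsHaarMeasure] {B : ℝ} (hB : 1 < B)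
    (m : Fin n) {s : {i : Fin n // i ≠ m} → ℝ} (hs : ∀ i, s i ∈ Set.Ico 1 B) {k : ℕ} (hk : 0 < k)
    {η : ℝ} (hη : 0 < η) (hηs : ∀ i, η < Real.log B - Real.log (s i)) :
    ∀ᶠ ε in 𝓝[>] (0 : ℝ),
      (∏ i, max (k * (Real.log (s i) - 2 * η)) 0 / (k * Real.log B)) ≤
        μ.real {g | g ∈ tube (diagDirection m) ε (logCube _ B k) ∧
            ∀ i : {i : Fin n // i ≠ m}, significand B (g i.1 i.1) ≤ s i} /
          μ.real (tube (diagDirection m) ε (logCube _ B k)) ∧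
      μ.real {g | g ∈ tube (diagDirection m) ε (logCube _ B k) ∧
            ∀ i : {i : Fin n // i ≠ m}, significand B (g i.1 i.1) ≤ s i} /
          μ.real (tube (diagDirection m) ε (logCube _ B k)) ≤
        ∏ i, (k * (Real.log (s i) + 2 * η) + η) / (k * Real.log B) := by
  obtain ⟨ε₀, hε₀, hc⟩ := exists_measure_tube_eq (linearIndependent_diagDirection m)
    (fun i => ⟨isDiag_diagDirection m i, trace_diagDirection m i⟩) μ
  obtain ⟨ε₁, hε₁, hexp⟩ := exists_abs_log_exp_apply_le (n := n) hη
  filter_upwards [Ioc_mem_nhdsGT hε₀, Ioc_mem_nhdsGT hε₁] with ε h1 h2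
  obtain ⟨c, hc0, hc⟩ := hc ε h1.1 h1.2
  set L := Real.log B with hL
  have hLpos : 0 < L := Real.log_pos hB
  have hs0 : ∀ i, 0 ≤ Real.log (s i) := fun i => Real.log_nonneg (hs i).1
  have hsL : ∀ i, Real.log (s i) < L := fun i => by linarith [hηs i]
  have hspos : ∀ i, 0 < s i := fun i => by linarith [(hs i).1]
  -- The perturbation is `u = log (exp Y)_ii`, uniformly at most `η` in absolute value over the
  -- cross-section.
  have hentry : ∀ (g : SLn n) (t : {i : Fin n // i ≠ m} → ℝ), ∀ Y ∈ crossSection (diagDirection m) ε,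
      (g : Matrix (Fin n) (Fin n) ℝ) =
        NormedSpace.exp (Fintype.linearCombination ℝ (diagDirection m) t) * NormedSpace.exp Y →
      ∀ i, ∃ u, |u| ≤ η ∧ (significand B (g i.1 i.1) ≤ s i ↔
        t i + u - ⌊(t i + u) / L⌋ * L ≤ Real.log (s i)) := by
    intro g t Y hY hg i
    obtain ⟨hpos, hlog⟩ := hexp Y (hY.2.2.trans_le h2.2) i.1
    refine ⟨_, hlog, ?_⟩
    have hgi : g i.1 i.1 = Real.exp (t i + Real.log (NormedSpace.exp Y i.1 i.1)) := by
      rw [Real.exp_add, Real.exp_log hpos, ← exp_mul_exp_diagDirection_apply, ← hg]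
    rw [hgi, significand_exp hB, Real.le_log_iff_exp_le (hspos i)]
  let S : Set (SLn n) := {g | g ∈ tube (diagDirection m) ε (logCube _ B k) ∧
    ∀ i : {i : Fin n // i ≠ m}, significand B (g i.1 i.1) ≤ s i}
  let Ji : Set ({i : Fin n // i ≠ m} → ℝ) :=
    Set.univ.pi fun i => innerCells L (Real.log (s i)) k η
  let Jo : Set ({i : Fin n // i ≠ m} → ℝ) :=
    Set.univ.pi fun i => outerCells L (Real.log (s i)) k η
  have hJi : MeasurableSet Ji := MeasurableSet.univ_pi fun _ => measurableSet_innerCells _ _ _ _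
  have hJo : MeasurableSet Jo := MeasurableSet.univ_pi fun _ => measurableSet_outerCells _ _ _ _
  have hinner : tube (diagDirection m) ε Ji ⊆ S := by
    intro g hg
    obtain ⟨t, ht, Y, hY, hgY⟩ := mem_tube_iff.1 hg
    refine ⟨mem_tube_iff.2 ⟨t, fun i => ?_, Y, hY, hgY⟩, fun i => ?_⟩
    · exact mem_Ico_of_mem_innerCells (hsL i) (hs0 i) hη.le (ht i trivial)
    · obtain ⟨u, hu, hiff⟩ := hentry g t Y hY hgY i
      exact hiff.2 (sub_floor_le_of_mem_innerCells (hsL i) (hs0 i) (ht i trivial) hu)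
  have houter : S ⊆ tube (diagDirection m) ε Jo := by
    rintro g ⟨hg, hgs⟩
    obtain ⟨t, ht, Y, hY, hgY⟩ := mem_tube_iff.1 hg
    refine mem_tube_iff.2 ⟨t, fun i _ => ?_, Y, hY, hgY⟩
    obtain ⟨u, hu, hiff⟩ := hentry g t Y hY hgY i
    exact mem_outerCells k (hηs i) (hs0 i) hη.le (ht i) hu (hiff.1 (hgs i))
  -- The maximum with `0` covers the case `log sᵢ < 2η`, where the inner cells are empty.
  have hvi : volume.real Ji = ∏ i, max (k * (Real.log (s i) - 2 * η)) 0 := by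
    rw [measureReal_def, volume_pi_pi, ENNReal.toReal_prod]
    exact Finset.prod_congr rfl fun i _ => by
      rw [volume_innerCells (hsL i) k hη.le, ENNReal.toReal_ofReal']
  have hJo_top : volume Jo ≠ ⊤ := by
    rw [volume_pi_pi]
    exact ENNReal.prod_ne_top fun i _ =>
      ((volume_outerCells_le L (hs0 i) k hη.le).trans_lt ENNReal.ofReal_lt_top).ne
  have hvo : volume.real Jo ≤ ∏ i, (k * (Real.log (s i) + 2 * η) + η) := by
    rw [measureReal_def, volume_pi_pi, ENNReal.toReal_prod]
    refine Finset.prod_le_prod (fun _ _ => ENNReal.toReal_nonneg) fun i _ => ?_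
    have := hs0 i
    exact ENNReal.toReal_le_of_le_ofReal (by positivity) (volume_outerCells_le L (hs0 i) k hη.le)
  have htop : μ (tube (diagDirection m) ε Jo) ≠ ⊤ := by
    rw [hc Jo hJo]
    exact ENNReal.mul_ne_top ENNReal.coe_ne_top hJo_top
  -- Only monotonicity and finiteness of the outer tube are used, so `S` need not be shown
  -- measurable.
  have hlow := measureReal_mono (μ := μ) hinner (measure_ne_top_of_subset houter htop)
  have hupp := measureReal_mono (μ := μ) houter htop
  rw [measureReal_tube_eq (hc Ji hJi), hvi] at hlow
  rw [measureReal_tube_eq (hc Jo hJo)] at hupp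
  have hcpos : (0 : ℝ) < c := NNReal.coe_pos.2 (pos_iff_ne_zero.2 hc0)
  have hkL : (0 : ℝ) < ∏ _i : {i : Fin n // i ≠ m}, (k * L) :=
    Finset.prod_pos fun _ _ => mul_pos (Nat.cast_pos.2 hk) hLpos
  rw [measureReal_tube_eq (hc _ (measurableSet_logCube _ B k)), volume_real_logCube hB, ← hL,
    Finset.prod_div_distrib, Finset.prod_div_distrib, div_le_div_iff₀ hkL (mul_pos hcpos hkL),
    div_le_div_iff₀ (mul_pos hcpos hkL) hkL]
  constructor
  · rw [← mul_assoc, mul_comm _ (c : ℝ)]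
    exact mul_le_mul_of_nonneg_right hlow hkL.le
  · rw [← mul_assoc, mul_comm _ (c : ℝ)]
    exact mul_le_mul_of_nonneg_right
      (hupp.trans (mul_le_mul_of_nonneg_left hvo hcpos.le)) hkL.le

/-- At fixed `k` both bounds tend to `∏ log sᵢ / log B` as `η → 0`, boundary term included. Choosing
`η` first and then `ε` small enough gives the inner limit exactly for every `k > 0`. -/
theorem hasDiagonalDigitLaw_benford {n : ℕ} (μ : Measure (SLn n)) [μ.IsHaarMeasure] {B : ℝ}
    (hB : 1 < B) (m : Fin n) : HasDiagonalDigitLaw μ B m fun _ => benfordDensity B := by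
  intro s hs
  refine ⟨fun _ => ∏ i, ∫ x in (1 : ℝ)..(s i), benfordDensity B x, fun k hk => ?_,
    tendsto_const_nhds⟩
  have hs0 : ∀ i, 0 ≤ Real.log (s i) := fun i => Real.log_nonneg (hs i).1
  have hk' : (k : ℝ) ≠ 0 := Nat.cast_ne_zero.2 hk.ne'
  have hp : (∏ i, ∫ x in (1 : ℝ)..(s i), benfordDensity B x) =
      ∏ i, Real.log (s i) / Real.log B :=
    Finset.prod_congr rfl fun i _ => integral_benfordDensity (hs i).1
  have hlo : Tendsto (fun η : ℝ => ∏ i, max (k * (Real.log (s i) - 2 * η)) 0 / (k * Real.log B))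
      (𝓝[>] 0) (𝓝 (∏ i, Real.log (s i) / Real.log B)) := by
    refine Tendsto.mono_left (Continuous.tendsto' (by fun_prop) 0 _ ?_) nhdsWithin_le_nhds
    refine Finset.prod_congr rfl fun i _ => ?_
    rw [mul_zero, sub_zero, max_eq_left (mul_nonneg k.cast_nonneg (hs0 i)), mul_div_mul_left _ _ hk']
  have hhi : Tendsto (fun η : ℝ => ∏ i, (k * (Real.log (s i) + 2 * η) + η) / (k * Real.log B))
      (𝓝[>] 0) (𝓝 (∏ i, Real.log (s i) / Real.log B)) := by
    refine Tendsto.mono_left (Continuous.tendsto' (by fun_prop) 0 _ ?_) nhdsWithin_le_nhds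
    refine Finset.prod_congr rfl fun i _ => ?_
    rw [mul_zero, add_zero, add_zero, mul_div_mul_left _ _ hk']
  have hsmall : ∀ᶠ η in 𝓝[>] (0 : ℝ), 0 < η ∧ ∀ i, η < Real.log B - Real.log (s i) := by
    refine (eventually_mem_nhdsWithin).and (eventually_all.2 fun i => ?_)
    exact nhdsWithin_le_nhds (Iio_mem_nhds
      (sub_pos.2 (Real.log_lt_log (by linarith [(hs i).1]) (hs i).2)))
  rw [hp]
  refine tendsto_order.2 ⟨fun a ha => ?_, fun a ha => ?_⟩
  · obtain ⟨η, hη, hη0, hηs⟩ := ((hlo.eventually (lt_mem_nhds ha)).and hsmall).exists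
    filter_upwards [diagonalDigit_bounds μ hB m hs hk hη0 hηs] with ε hε using hη.trans_le hε.1
  · obtain ⟨η, hη, hη0, hηs⟩ := ((hhi.eventually (gt_mem_nhds ha)).and hsmall).exists
    filter_upwards [diagonalDigit_bounds μ hB m hs hk hη0 hηs] with ε hε using hε.2.trans_lt hη

end

/-! ### Assembly of the theorem, with `ludMeasure n` as the Haar measure. -/

theorem mainTheorem1 (n : ℕ) :
    (diagMeasure n).IsHaarMeasure ∧
    ∃ μ : Measure (SLn n), μ.IsHaarMeasure ∧
      (∀ φ : SLn n → ℂ, Continuous φ → HasCompactSupport φ →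
        Integrable
          (fun p : (StrictLower n → ℝ) × (StrictUpper n → ℝ) × diagOne n =>
            φ (ludMap p.1 p.2.1 p.2.2))
          ((volume : Measure (StrictLower n → ℝ)).prod
            ((volume : Measure (StrictUpper n → ℝ)).prod (diagMeasure n))) ∧
        ∫ g, φ g ∂μ = ∫ x : StrictLower n → ℝ, ∫ y : StrictUpper n → ℝ,
          ∫ a : diagOne n, φ (ludMap x y a) ∂(diagMeasure n)) ∧
      (∀ B : ℝ, 1 < B →
        (∀ (d : ℕ) (H : Fin d → Matrix (Fin n) (Fin n) ℝ), LinearIndependent ℝ H →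
          (∀ i, (H i).IsDiag ∧ (H i).trace = 0) →
          HasJointDigitLaw μ B H (fun _ => benfordDensity B)) ∧
        (∀ m : Fin n, HasDiagonalDigitLaw μ B m (fun _ => benfordDensity B))) := by
  have hμ := isHaarMeasure_ludMeasure n
  exact ⟨isHaarMeasure_diagMeasure n, ludMeasure n, hμ,
    fun _ hφ hφc => integrable_and_integral_ludMeasure hφ hφc, fun B hB =>
      ⟨fun _ _ hlin hH => hasJointDigitLaw_benford hlin hH _ hB,
        fun m => hasDiagonalDigitLaw_benford _ hB m⟩⟩
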